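/- Let $\mathbb S=\{I\in\mathbb H: I^2=-1\}$ and, for $I\in\mathbb S$, let $\mathbb C_I=\mathbb R+I\mathbb R$, with Lebesgue measure $d\lambda_I(x+Iy)=dx\,dy$; write $f_I$ for the restriction to $\mathbb C_I$ of a function $f:\mathbb H\to\mathbb H$. For $m\ge 1$, a function $f:\mathbb H\to\mathbb H$ is called (left) slice polyanalytic of order $m$ if $f(x+Iy)=\alpha(x,y)+I\beta(x,y)$ for all $x,y\in\mathbb R$ and $I\in\mathbb S$, where $\alpha,\beta:\mathbb R^2\to\mathbb H$ are of class $C^m$, $\alpha(x,-y)=\alpha(x,y)$, $\beta(x,-y)=-\beta(x,y)$, and $$\frac1{2^m}(\partial_x+I\partial_y)^m\bigl(\alpha(x,y)+I\beta(x,y)\bigr)=0\qquad\text{for all } I\in\mathbb S \text{ and } x,y\in\mathbb R .$$ For $m=1$ it is called slice regular. The slice derivative $\partial_s$ of a sufficiently smooth slice function acts on each slice $\mathbb C_I$ as $\partial_I=\frac12(\partial_x-I\partial_y)$ (at real points the value does not depend on $I$). For $I\in\mathbb S$ and $m\ge1$ let $\widetilde{\mathcal F}^{m}_I(\mathbb H)$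 be the right $\mathbb H$-vector space of all slice polyanalytic functions $f$ of order $m$ with $$\int_{\mathbb C_I}|f_I(q)|^2e^{-2\pi|q|^2}\,d\lambda_I(q)<\infty ,$$ and for $j\ge0$ let $\mathcal F^{j}_{T,I}(\mathbb H)$ be the right $\mathbb H$-vector space of all $f:\mathbb H\to\mathbb H$ that satisfy the same integrability condition and for which there is a slice regular function $H:\mathbb H\to\mathbb H$ with $$f(q)=(-1)^j\sqrt{\frac1{(2\pi)^j\,j!}}\;e^{2\pi|q|^2}\,\partial_s^j\bigl(e^{-2\pi|q|^2}H(q)\bigr)\qquad\text{for all } q\in\mathbb H .$$ Theorem. Let $n\ge0$. The spaces $\widetilde{\mathcal F}^{n+1}_I(\mathbb H)$ and $\mathcal F^{j}_{T,I}(\mathbb H)$, $0\le j\le n$, do not depend on $I\in\mathbb S$; denote them by $\widetilde{\mathcal F}^{n+1}_{Slice}(\mathbb H)$ and $\mathcal F^{j}_T(\mathbb H)$. The quaternionic slice polyanalytic Fock space of order $n+1$ is the direct sum of the quaternionic true polyanalytic Fock spaces of orders $0,\dots,n$: $$\widetilde{\mathcal F}^{n+1}_{Slice}(\mathbb H)=\bigoplus_{j=0}^{n}\mathcal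 F^{j}_T(\mathbb H),$$ that is, the subspaces $\mathcal F^{j}_T(\mathbb H)$, $0\le j\le n$, are linearly independent and their sum is $\widetilde{\mathcal F}^{n+1}_{Slice}(\mathbb H)$. -/

import Mathlib

open MeasureTheory
open scoped Quaternion ContDiff

noncomputable section

namespace SliceFock

/-- The sphere `𝕊 = {q ∈ ℍ : q² = -1}` of imaginary units. -/
def imagUnits : Set ℍ := {q | q ^ 2 = -1}

/-- The point `x + I y` of the slice `ℂ_I = ℝ + I ℝ`, for `p = (x, y)`. -/
def slicePt (I : ℍ) (p : ℝ × ℝ) : ℍ := (p.1 : ℍ) + I * (p.2 : ℍ)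

/-- The restriction `f_I` of `f` to the slice `ℂ_I`, in the coordinates `(x, y)`. -/
def restr (f : ℍ → ℍ) (I : ℍ) : ℝ × ℝ → ℍ := fun p => f (slicePt I p)

/-- `½ (∂/∂x + I ∂/∂y)`, where `I` multiplies from the left. -/
def dbar (I : ℍ) (g : ℝ × ℝ → ℍ) : ℝ × ℝ → ℍ :=
  fun p => (1 / 2 : ℝ) • (fderiv ℝ g p (1, 0) + I * fderiv ℝ g p (0, 1))

/-- `∂_I = ½ (∂/∂x - I ∂/∂y)`, where `I` multiplies from the left. -/
def dslice (I : ℍ) (g : ℝ × ℝ → ℍ) : ℝ × ℝ → ℍ :=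
  fun p => (1 / 2 : ℝ) • (fderiv ℝ g p (1, 0) - I * fderiv ℝ g p (0, 1))

/-- `f` is a (left) slice polyanalytic function of order `n` on `ℍ`: it is a slice function
`f (x + I y) = α (x, y) + I β (x, y)`, with `α` even in `y`, `β` odd in `y`, both of class `C^n`,
and it satisfies the poly Cauchy-Riemann equation of order `n` on each slice. -/
def IsSlicePolyanalytic (n : ℕ) (f : ℍ → ℍ) : Prop :=
  ∃ α β : ℝ × ℝ → ℍ,
    (∀ x y : ℝ, α (x, -y) = α (x, y)) ∧ (∀ x y : ℝ, β (x, -y) = -β (x, y)) ∧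
    ContDiff ℝ n α ∧ ContDiff ℝ n β ∧
    (∀ I ∈ imagUnits, ∀ p : ℝ × ℝ, f (slicePt I p) = α p + I * β p) ∧
    (∀ I ∈ imagUnits, ∀ p : ℝ × ℝ, (dbar I)^[n] (fun p' => α p' + I * β p') p = 0)

/-- Slice regular functions on `ℍ`: the slice polyanalytic functions of order `1`. -/
def IsSliceRegular (f : ℍ → ℍ) : Prop := IsSlicePolyanalytic 1 f

/-- `∫_{ℂ_I} |f_I(q)|² exp(-2π|q|²) dλ_I(q) < ∞`. -/
def FockIntegrable (I : ℍ) (f : ℍ → ℍ) : Prop :=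
  Integrable (fun p : ℝ × ℝ =>
    ‖restr f I p‖ ^ 2 * Real.exp (-(2 * Real.pi * ‖slicePt I p‖ ^ 2))) volume

/-- `f(q) = (-1)^n √(1/((2π)^n n!)) exp(2π|q|²) ∂_s^n (exp(-2π|q|²) H(q))` for all `q ∈ ℍ`.
The slice derivative `∂_s` is `∂_J` on the slice `ℂ_J`, so the equation is written slice by slice;
at real points (which lie on every slice) it is required for every `J`. -/
def IsTruePolyOf (n : ℕ) (f H : ℍ → ℍ) : Prop :=
  ∀ J ∈ imagUnits, ∀ p : ℝ × ℝ,
    restr f J p =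
      ((-1) ^ n * Real.sqrt (1 / ((2 * Real.pi) ^ n * (n.factorial : ℝ))) *
          Real.exp (2 * Real.pi * ‖slicePt J p‖ ^ 2)) •
        (dslice J)^[n]
          (restr (fun q => Real.exp (-(2 * Real.pi * ‖q‖ ^ 2)) • H q) J) p

/-! ### Facts needed to see that the spaces are right `ℍ`-linear -/

lemma dbar_contDiff {I : ℍ} {g : ℝ × ℝ → ℍ} {n : ℕ} (hg : ContDiff ℝ (n + 1 : ℕ) g) :
    ContDiff ℝ n (dbar I g) := by
  have h : ContDiff ℝ n (fderiv ℝ g) := hg.fderiv_right (by norm_cast)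
  exact ((h.clm_apply contDiff_const).add
    (contDiff_const.mul (h.clm_apply contDiff_const))).const_smul _

lemma dslice_contDiff {I : ℍ} {g : ℝ × ℝ → ℍ} (hg : ContDiff ℝ ∞ g) :
    ContDiff ℝ ∞ (dslice I g) := by
  have h : ContDiff ℝ ∞ (fderiv ℝ g) := hg.fderiv_right (by norm_cast)
  exact ((h.clm_apply contDiff_const).sub
    (contDiff_const.mul (h.clm_apply contDiff_const))).const_smul _

lemma dbar_add {I : ℍ} {g h : ℝ × ℝ → ℍ} (hg : Differentiable ℝ g) (hh : Differentiable ℝ h) :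
    dbar I (fun p => g p + h p) = fun p => dbar I g p + dbar I h p := by
  funext p
  have : fderiv ℝ (fun p => g p + h p) p = fderiv ℝ g p + fderiv ℝ h p :=
    fderiv_add (hg p) (hh p)
  simp only [dbar, this, add_apply, mul_add, ← smul_add]
  congr 1; abel

lemma dslice_add {I : ℍ} {g h : ℝ × ℝ → ℍ} (hg : Differentiable ℝ g) (hh : Differentiable ℝ h) :
    dslice I (fun p => g p + h p) = fun p => dslice I g p + dslice I h p := by
  funext p
  have : fderiv ℝ (fun p => g p + h p) p = fderiv ℝ g p + fderiv ℝ h p :=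
    fderiv_add (hg p) (hh p)
  simp only [dslice, this, add_apply, mul_add, ← smul_add]
  congr 1; abel

lemma fderiv_mul_right {g : ℝ × ℝ → ℍ} (hg : Differentiable ℝ g) (a : ℍ) (p v : ℝ × ℝ) :
    fderiv ℝ (fun p => g p * a) p v = fderiv ℝ g p v * a := by
  rw [fderiv_mul_const' (hg p)]
  simp

lemma dbar_mul_right {I : ℍ} {g : ℝ × ℝ → ℍ} (hg : Differentiable ℝ g) (a : ℍ) :
    dbar I (fun p => g p * a) = fun p => dbar I g p * a := by
  funext p
  simp only [dbar, fderiv_mul_right hg, smul_mul_assoc, add_mul, mul_assoc]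

lemma dslice_mul_right {I : ℍ} {g : ℝ × ℝ → ℍ} (hg : Differentiable ℝ g) (a : ℍ) :
    dslice I (fun p => g p * a) = fun p => dslice I g p * a := by
  funext p
  simp only [dslice, fderiv_mul_right hg, smul_mul_assoc, sub_mul, mul_assoc]

lemma differentiable_of_succ {g : ℝ × ℝ → ℍ} {n : ℕ} (hg : ContDiff ℝ (n + 1 : ℕ) g) :
    Differentiable ℝ g :=
  hg.differentiable (by norm_cast)

lemma dbar_iterate_add {I : ℍ} (n : ℕ) : ∀ {g h : ℝ × ℝ → ℍ}, ContDiff ℝ n g → ContDiff ℝ n h →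
    (dbar I)^[n] (fun p => g p + h p) = fun p => (dbar I)^[n] g p + (dbar I)^[n] h p := by
  induction n with
  | zero => intro g h _ _; rfl
  | succ n ih =>
    intro g h hg hh
    simp only [Function.iterate_succ_apply]
    rw [dbar_add (differentiable_of_succ hg) (differentiable_of_succ hh)]
    exact ih (dbar_contDiff hg) (dbar_contDiff hh)

lemma dbar_iterate_mul_right {I : ℍ} (n : ℕ) (a : ℍ) : ∀ {g : ℝ × ℝ → ℍ}, ContDiff ℝ n g →
    (dbar I)^[n] (fun p => g p * a) = fun p => (dbar I)^[n] g p * a := by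
  induction n with
  | zero => intro g _; rfl
  | succ n ih =>
    intro g hg
    simp only [Function.iterate_succ_apply]
    rw [dbar_mul_right (differentiable_of_succ hg)]
    exact ih (dbar_contDiff hg)

lemma dslice_iterate_contDiff {I : ℍ} (n : ℕ) {g : ℝ × ℝ → ℍ} (hg : ContDiff ℝ ∞ g) :
    ContDiff ℝ ∞ ((dslice I)^[n] g) := by
  induction n with
  | zero => exact hg
  | succ n ih => rw [Function.iterate_succ_apply']; exact dslice_contDiff ih

lemma dslice_iterate_add {I : ℍ} (n : ℕ) {g h : ℝ × ℝ → ℍ} (hg : ContDiff ℝ ∞ g)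
    (hh : ContDiff ℝ ∞ h) :
    (dslice I)^[n] (fun p => g p + h p) = fun p => (dslice I)^[n] g p + (dslice I)^[n] h p := by
  induction n with
  | zero => rfl
  | succ n ih =>
    simp only [Function.iterate_succ_apply', ih]
    exact dslice_add ((dslice_iterate_contDiff n hg).differentiable (by simp))
      ((dslice_iterate_contDiff n hh).differentiable (by simp))

lemma dslice_iterate_mul_right {I : ℍ} (n : ℕ) (a : ℍ) {g : ℝ × ℝ → ℍ} (hg : ContDiff ℝ ∞ g) :
    (dslice I)^[n] (fun p => g p * a) = fun p => (dslice I)^[n] g p * a := by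
  induction n with
  | zero => rfl
  | succ n ih =>
    simp only [Function.iterate_succ_apply', ih]
    exact dslice_mul_right ((dslice_iterate_contDiff n hg).differentiable (by simp)) a

namespace IsSlicePolyanalytic

variable {n : ℕ} {f g : ℍ → ℍ}

lemma zero (n : ℕ) : IsSlicePolyanalytic n (0 : ℍ → ℍ) := by
  refine ⟨0, 0, by simp, by simp, contDiff_const, contDiff_const, by simp, ?_⟩
  intro I _ p
  have h := dbar_iterate_mul_right (I := I) n 0 (g := fun _ => 0) contDiff_const
  simp only [mul_zero] at h
  simp [h]

lemma add (hf : IsSlicePolyanalytic n f) (hg : IsSlicePolyanalytic n g) :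
    IsSlicePolyanalytic n (f + g) := by
  obtain ⟨α, β, h1, h2, h3, h4, h5, h6⟩ := hf
  obtain ⟨γ, δ, k1, k2, k3, k4, k5, k6⟩ := hg
  refine ⟨fun p => α p + γ p, fun p => β p + δ p, fun x y => by simp only [h1, k1],
    fun x y => by simp only [h2, k2, neg_add], h3.add k3, h4.add k4, ?_, ?_⟩
  · intro I hI p
    simp only [Pi.add_apply, h5 I hI, k5 I hI, mul_add]; abel
  · intro I hI p
    have e : (fun p => α p + γ p + I * (β p + δ p)) =
        fun p => (α p + I * β p) + (γ p + I * δ p) := by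
      funext p; rw [mul_add]; abel
    rw [e, dbar_iterate_add n (h3.add (contDiff_const.mul h4))
      (k3.add (contDiff_const.mul k4))]
    simp only [h6 I hI, k6 I hI, add_zero]

lemma mul_right (hf : IsSlicePolyanalytic n f) (a : ℍ) :
    IsSlicePolyanalytic n (fun q => f q * a) := by
  obtain ⟨α, β, h1, h2, h3, h4, h5, h6⟩ := hf
  refine ⟨fun p => α p * a, fun p => β p * a, fun x y => by simp only [h1],
    fun x y => by simp only [h2, neg_mul], h3.mul contDiff_const, h4.mul contDiff_const, ?_, ?_⟩
  · intro I hI p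
    simp only [h5 I hI, add_mul, mul_assoc]
  · intro I hI p
    have e : (fun p => α p * a + I * (β p * a)) = fun p => (α p + I * β p) * a := by
      funext p; rw [add_mul, mul_assoc]
    rw [e, dbar_iterate_mul_right n a (h3.add (contDiff_const.mul h4))]
    simp only [h6 I hI, zero_mul]

lemma contDiff_restr (hf : IsSlicePolyanalytic n f) {I : ℍ} (hI : I ∈ imagUnits) :
    ContDiff ℝ n (restr f I) := by
  obtain ⟨α, β, -, -, h3, h4, h5, -⟩ := hf
  have : restr f I = fun p => α p + I * β p := by funext p; exact h5 I hI p
  rw [this]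
  exact h3.add (contDiff_const.mul h4)

end IsSlicePolyanalytic

lemma re_imagUnit {I : ℍ} (hI : I ∈ imagUnits) : I.re = 0 := by
  have h : I * I = -1 := by rw [← sq]; exact hI
  have h0 := congrArg QuaternionAlgebra.re h
  have h1 := congrArg QuaternionAlgebra.imI h
  have h2 := congrArg QuaternionAlgebra.imJ h
  have h3 := congrArg QuaternionAlgebra.imK h
  simp at h0 h1 h2 h3
  by_contra hre
  have e1 : I.imI = 0 := by
    have : I.re * I.imI = 0 := by linarith
    exact (mul_eq_zero.1 this).resolve_left hre
  have e2 : I.imJ = 0 := by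
    have : I.re * I.imJ = 0 := by linarith
    exact (mul_eq_zero.1 this).resolve_left hre
  have e3 : I.imK = 0 := by
    have : I.re * I.imK = 0 := by linarith
    exact (mul_eq_zero.1 this).resolve_left hre
  rw [e1, e2, e3] at h0
  nlinarith [sq_nonneg I.re]

lemma norm_imagUnit {I : ℍ} (hI : I ∈ imagUnits) : ‖I‖ = 1 := by
  have h : ‖I‖ ^ 2 = 1 := by
    rw [← norm_pow, show I ^ 2 = -1 from hI, norm_neg, norm_one]
  nlinarith [norm_nonneg I]

lemma norm_slicePt_sq {I : ℍ} (hI : I ∈ imagUnits) (p : ℝ × ℝ) :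
    ‖slicePt I p‖ ^ 2 = p.1 ^ 2 + p.2 ^ 2 := by
  have hre := re_imagUnit hI
  have hn : ‖I‖ ^ 2 = 1 := by rw [norm_imagUnit hI]; norm_num
  rw [sq, ← Quaternion.normSq_eq_norm_mul_self, Quaternion.normSq_def'] at hn ⊢
  simp [slicePt, hre] at hn ⊢
  linear_combination p.2 ^ 2 * hn

/-- `ℍ` as a complex normed space, `i ∈ ℂ` acting as left multiplication by `I`. -/
abbrev complexModule {I : ℍ} (hI : I ∈ imagUnits) : Module ℂ ℍ :=
  Module.compHom ℍ (Complex.lift ⟨I, by rw [← sq]; exact hI⟩ : ℂ →ₐ[ℝ] ℍ).toRingHom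

lemma complexModule_smul {I : ℍ} (hI : I ∈ imagUnits) (z : ℂ) (q : ℍ) :
    (complexModule hI).toSMul.smul z q = slicePt I (z.re, z.im) * q := by
  change (Complex.lift ⟨I, _⟩ : ℂ →ₐ[ℝ] ℍ) z * q = _
  rw [Complex.lift_apply, Complex.liftAux_apply, slicePt]
  congr 2
  rw [← Quaternion.coe_commutes, Quaternion.coe_mul_eq_smul]

abbrev complexNormedSpace {I : ℍ} (hI : I ∈ imagUnits) : NormedSpace ℂ ℍ :=
  { complexModule hI with
    norm_smul_le := by
      intro z q
      change ‖(complexModule hI).toSMul.smul z q‖ ≤ _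
      rw [complexModule_smul, norm_mul]
      gcongr
      refine le_of_eq ((sq_eq_sq₀ (norm_nonneg _) (norm_nonneg _)).1 ?_)
      rw [norm_slicePt_sq hI, Complex.sq_norm, Complex.normSq_apply]
      ring }

/-- Slice regular functions are smooth on each slice. -/
lemma IsSliceRegular.contDiff_restr {H : ℍ → ℍ} (hH : IsSliceRegular H) {I : ℍ}
    (hI : I ∈ imagUnits) : ContDiff ℝ ∞ (restr H I) := by
  have h1 : ContDiff ℝ 1 (restr H I) := by
    simpa using IsSlicePolyanalytic.contDiff_restr hH hI
  have hd : Differentiable ℝ (restr H I) := h1.differentiable (by simp)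
  have hcr : ∀ p, fderiv ℝ (restr H I) p (0, 1) = I * fderiv ℝ (restr H I) p (1, 0) := by
    obtain ⟨α, β, -, -, h3, h4, h5, h6⟩ := hH
    have e : restr H I = fun p => α p + I * β p := by funext p; exact h5 I hI p
    intro p
    have h := h6 I hI p
    rw [← e, Function.iterate_one, dbar, smul_eq_zero] at h
    have h' := h.resolve_left (by norm_num)
    have hII : I * I = -1 := by rw [← sq]; exact hI
    have h'' : I * (fderiv ℝ (restr H I) p (1, 0) + I * fderiv ℝ (restr H I) p (0, 1)) = 0 := by
      rw [h', mul_zero]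
    rw [mul_add, ← mul_assoc, hII, neg_one_mul, ← sub_eq_add_neg, sub_eq_zero] at h''
    exact h''.symm
  let _ := complexNormedSpace hI
  have hsm : ∀ (z : ℂ) (q : ℍ), z • q = slicePt I (z.re, z.im) * q := complexModule_smul hI
  have _ : IsScalarTower ℝ ℂ ℍ := by
    refine IsScalarTower.of_algebraMap_smul fun r q => ?_
    rw [hsm, ← Quaternion.coe_mul_eq_smul]
    simp [slicePt]
  let F : ℂ → ℍ := fun z => restr H I (Complex.equivRealProdCLM z)
  have hF : Differentiable ℂ F := by
    intro z
    have hz : HasFDerivAt F ((fderiv ℝ (restr H I) (Complex.equivRealProdCLM z)).comp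
        (Complex.equivRealProdCLM : ℂ →L[ℝ] ℝ × ℝ)) z :=
      (hd _).hasFDerivAt.comp z Complex.equivRealProdCLM.hasFDerivAt
    let c : ℍ := fderiv ℝ (restr H I) (Complex.equivRealProdCLM z) (1, 0)
    have hL : ((ContinuousLinearMap.toSpanSingleton ℂ c).restrictScalars ℝ) =
        (fderiv ℝ (restr H I) (Complex.equivRealProdCLM z)).comp
        (Complex.equivRealProdCLM : ℂ →L[ℝ] ℝ × ℝ) := by
      ext1 w
      have hw : Complex.equivRealProdCLM w = w.re • ((1, 0) : ℝ × ℝ) + w.im • ((0, 1) : ℝ × ℝ) := by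
        simp [Complex.equivRealProdCLM_apply]
      simp only [ContinuousLinearMap.coe_restrictScalars', ContinuousLinearMap.comp_apply,
        ContinuousLinearEquiv.coe_coe, ContinuousLinearMap.toSpanSingleton_apply]
      rw [hw, map_add, map_smul, map_smul, hcr, hsm, slicePt, add_mul, Quaternion.coe_mul_eq_smul,
        mul_assoc, Quaternion.coe_mul_eq_smul, mul_smul_comm]
    exact (hasFDerivAt_of_restrictScalars ℝ hz hL).differentiableAt
  have hFs : ContDiff ℝ ∞ F := (hF.contDiff (n := ∞)).restrict_scalars ℝ
  have e : restr H I = F ∘ Complex.equivRealProdCLM.symm := by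
    funext p; simp [F]
  rw [e]
  exact hFs.comp Complex.equivRealProdCLM.symm.contDiff

lemma contDiff_restr_weight {H : ℍ → ℍ} (hH : IsSliceRegular H) {I : ℍ} (hI : I ∈ imagUnits) :
    ContDiff ℝ ∞ (restr (fun q => Real.exp (-(2 * Real.pi * ‖q‖ ^ 2)) • H q) I) := by
  have e : restr (fun q => Real.exp (-(2 * Real.pi * ‖q‖ ^ 2)) • H q) I =
      fun p : ℝ × ℝ => Real.exp (-(2 * Real.pi * (p.1 ^ 2 + p.2 ^ 2))) • restr H I p := by
    funext p; simp only [restr, norm_slicePt_sq hI]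
  rw [e]
  have c : ContDiff ℝ ∞ (fun p : ℝ × ℝ => Real.exp (-(2 * Real.pi * (p.1 ^ 2 + p.2 ^ 2)))) := by
    fun_prop
  exact c.smul (hH.contDiff_restr hI)

lemma IsTruePolyOf.continuous_restr {n : ℕ} {f H : ℍ → ℍ} (h : IsTruePolyOf n f H)
    (hH : IsSliceRegular H) {I : ℍ} (hI : I ∈ imagUnits) : Continuous (restr f I) := by
  rw [show restr f I = _ from funext (h I hI)]
  have c : Continuous (fun p : ℝ × ℝ => (-1 : ℝ) ^ n *
      Real.sqrt (1 / ((2 * Real.pi) ^ n * (n.factorial : ℝ))) *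
      Real.exp (2 * Real.pi * ‖slicePt I p‖ ^ 2)) := by
    simp only [norm_slicePt_sq hI]
    fun_prop
  exact c.smul (dslice_iterate_contDiff n (contDiff_restr_weight hH hI)).continuous

lemma FockIntegrable.zero (I : ℍ) : FockIntegrable I 0 := by
  simp [FockIntegrable, restr]

lemma FockIntegrable.add {I : ℍ} {f g : ℍ → ℍ} (hf : FockIntegrable I f)
    (hg : FockIntegrable I g) (cf : Continuous (restr f I)) (cg : Continuous (restr g I)) :
    FockIntegrable I (f + g) := by
  have c : Continuous (restr (f + g) I) := cf.add cg
  refine ((hf.const_mul 2).add (hg.const_mul 2)).mono' ?_ (Filter.Eventually.of_forall fun p => ?_)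
  · refine Continuous.aestronglyMeasurable ?_
    have c' : Continuous (slicePt I) := (Quaternion.continuous_coe.comp continuous_fst).add
      (continuous_const.mul (Quaternion.continuous_coe.comp continuous_snd))
    fun_prop
  · have hE := (Real.exp_pos (-(2 * Real.pi * ‖slicePt I p‖ ^ 2))).le
    rw [Real.norm_of_nonneg (by positivity)]
    have h1 : ‖restr (f + g) I p‖ ≤ ‖restr f I p‖ + ‖restr g I p‖ := norm_add_le _ _
    have h2 : ‖restr (f + g) I p‖ ^ 2 ≤ 2 * ‖restr f I p‖ ^ 2 + 2 * ‖restr g I p‖ ^ 2 := by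
      nlinarith [sq_nonneg (‖restr f I p‖ - ‖restr g I p‖), norm_nonneg (restr (f + g) I p)]
    have h3 := mul_le_mul_of_nonneg_right h2 hE
    simp only [Pi.add_apply]
    linarith

lemma FockIntegrable.mul_right {I : ℍ} {f : ℍ → ℍ} (hf : FockIntegrable I f) (a : ℍ) :
    FockIntegrable I (fun q => f q * a) := by
  refine (hf.const_mul (‖a‖ ^ 2)).congr (Filter.Eventually.of_forall fun p => ?_)
  simp only [restr, norm_mul]
  ring

lemma IsTruePolyOf.add {n : ℕ} {f g H K : ℍ → ℍ} (hf : IsTruePolyOf n f H)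
    (hg : IsTruePolyOf n g K) (hH : IsSliceRegular H) (hK : IsSliceRegular K) :
    IsTruePolyOf n (f + g) (H + K) := by
  intro J hJ p
  have e : restr (fun q => Real.exp (-(2 * Real.pi * ‖q‖ ^ 2)) • (H + K) q) J =
      fun p => restr (fun q => Real.exp (-(2 * Real.pi * ‖q‖ ^ 2)) • H q) J p +
        restr (fun q => Real.exp (-(2 * Real.pi * ‖q‖ ^ 2)) • K q) J p := by
    funext p; simp only [restr, Pi.add_apply, smul_add]
  rw [e, dslice_iterate_add n (contDiff_restr_weight hH hJ) (contDiff_restr_weight hK hJ),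
    smul_add, ← hf J hJ p, ← hg J hJ p]
  rfl

lemma IsTruePolyOf.mul_right {n : ℕ} {f H : ℍ → ℍ} (hf : IsTruePolyOf n f H)
    (hH : IsSliceRegular H) (a : ℍ) :
    IsTruePolyOf n (fun q => f q * a) (fun q => H q * a) := by
  intro J hJ p
  have e : restr (fun q => Real.exp (-(2 * Real.pi * ‖q‖ ^ 2)) • (H q * a)) J =
      fun p => restr (fun q => Real.exp (-(2 * Real.pi * ‖q‖ ^ 2)) • H q) J p * a := by
    funext p; simp only [restr, smul_mul_assoc]
  rw [e, dslice_iterate_mul_right n a (contDiff_restr_weight hH hJ), ← smul_mul_assoc,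
    ← hf J hJ p]
  rfl

/-! ### The spaces, as right `ℍ`-linear subspaces of `ℍ → ℍ` -/

/-- The slice polyanalytic Fock space of order `m`, with the integral taken on the slice `ℂ_I`:
slice polyanalytic functions of order `m` with `∫_{ℂ_I} |f_I|² exp(-2π|q|²) dλ_I < ∞`.
The scalars act by `(f a)(q) = f(q) a`. -/
def polyFock (I : imagUnits) (m : ℕ) : Submodule ℍᵐᵒᵖ (ℍ → ℍ) where
  carrier := {f | IsSlicePolyanalytic m f ∧ FockIntegrable I f}
  zero_mem' := ⟨IsSlicePolyanalytic.zero m, FockIntegrable.zero I⟩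
  add_mem' := fun hf hg => ⟨hf.1.add hg.1,
    hf.2.add hg.2 (hf.1.contDiff_restr I.2).continuous (hg.1.contDiff_restr I.2).continuous⟩
  smul_mem' := fun a _ hf => ⟨hf.1.mul_right a.unop, hf.2.mul_right a.unop⟩

/-- The true polyanalytic Fock space `F_T^n(ℍ)`, with the integral taken on the slice `ℂ_I`. -/
def truePolyFock (I : imagUnits) (n : ℕ) : Submodule ℍᵐᵒᵖ (ℍ → ℍ) where
  carrier := {f | FockIntegrable I f ∧ ∃ H : ℍ → ℍ, IsSliceRegular H ∧ IsTruePolyOf n f H}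
  zero_mem' := by
    refine ⟨FockIntegrable.zero I, 0, IsSlicePolyanalytic.zero 1, fun J hJ p => ?_⟩
    have e := dslice_iterate_mul_right (I := J) n 0 (g := fun _ => 0) contDiff_const
    simp only [mul_zero] at e
    have e' : restr (fun q => Real.exp (-(2 * Real.pi * ‖q‖ ^ 2)) • (0 : ℍ → ℍ) q) J =
        fun _ => 0 := by
      funext p; simp [restr]
    rw [e', e, smul_zero]
    rfl
  add_mem' := by
    rintro f g ⟨hf, H, hH, hfH⟩ ⟨hg, K, hK, hgK⟩
    exact ⟨hf.add hg (hfH.continuous_restr hH I.2) (hgK.continuous_restr hK I.2),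
      H + K, IsSlicePolyanalytic.add hH hK, hfH.add hgK hH hK⟩
  smul_mem' := by
    rintro a f ⟨hf, H, hH, hfH⟩
    exact ⟨hf.mul_right a.unop, fun q => H q * a.unop,
      IsSlicePolyanalytic.mul_right hH a.unop, hfH.mul_right hH a.unop⟩

end SliceFock

end

/-! Conjugating by the Gaussian turns `∂_s` into `∂_s - 2π q̄`, so up to a nonzero constant the
elements of the `j`-th true space are the Fock-integrable functions `T_j H = (∂_s - 2π q̄)^j H` with
`H` slice regular. Since `∂̄ q̄ = 1`, `∂̄^n T_n H = (-2π)^n n! H`; peeling off leading terms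
therefore writes every slice polyanalytic function of order `n + 1` as `∑_{j ≤ n} T_j H_j`, with no
integrability involved (`IsSlicePolyanalytic.exists_eq_sum`).

The analytic point is that if such a sum is square integrable, then so is each component.
Orthogonality is not available, since the components are not known to lie in `L²`. Instead, on one
slice, `ℍ` is a complex Banach space under left multiplication by `I`, and the `H_j` become entire
functions. The twisted translations `g ↦ e^{-2π ā w} g(a + w)` commute with `T_j`, and by Cauchy's
formula the mean of `T_j F` over `|w| = r` is `p_j(r²) T_j F(0)` with `deg p_j = j`. Hence the
twisted mean of `T_j H` about `a` is `p_j(r²) T_j H(a)`. An `n`-th finite difference in `r²` kills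
all `j < n` and leaves a nonzero multiple of `T_n H_n(a)` (`sum_circleAverage_twist`). The top
component is thus a finite combination of twisted circle means of the sum, and these are bounded on
the Gaussian `L²` space (`lintegral_fockDensity_truePoly_lt_top`). The same formula applied to a
vanishing sum gives linear independence.

Independence of the slice follows from the representation formula: the values on one slice at `(x,
±y)` determine those on every other slice, with a norm bound. -/

open MeasureTheory
open scoped Quaternion ContDiff

noncomputable section

namespace SliceFock

/-! ### Entire functions: the operators `(∂ - 2π z̄)^j` and twisted translations -/

section Complex

open Finset

variable {E : Type*} [NormedAddCommGroup E] [NormedSpace ℂ E]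

/-- `(∂ - 2π z̄)^j H` for an entire function `H`, expanded by the binomial theorem. -/
def truePoly (j : ℕ) (H : ℂ → E) (z : ℂ) : E :=
  ∑ i ∈ range (j + 1), ((j.choose i : ℂ) * (-(2 * Real.pi) * star z) ^ i) •
    iteratedDeriv (j - i) H z

lemma iteratedDeriv_exp_smul [CompleteSpace E] (j : ℕ) (c : ℂ) {H : ℂ → E}
    (hH : Differentiable ℂ H) (z : ℂ) :
    iteratedDeriv j (fun w => Complex.exp (c * w) • H w) z =
      Complex.exp (c * z) • ∑ i ∈ range (j + 1), ((j.choose i : ℂ) * c ^ i) •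
        iteratedDeriv (j - i) H z := by
  have h1 : ContDiff ℂ j (fun w : ℂ => Complex.exp (c * w)) := by fun_prop
  have h2 : ContDiff ℂ j H := hH.contDiff
  have h := iteratedDerivWithin_smul (Set.mem_univ z) uniqueDiffOn_univ
    h1.contDiffAt.contDiffWithinAt h2.contDiffAt.contDiffWithinAt
  simp only [iteratedDerivWithin_univ] at h
  refine Eq.trans h ?_
  rw [smul_sum]
  refine sum_congr rfl fun i _ => ?_
  rw [iteratedDeriv_cexp_const_mul, ← Nat.cast_smul_eq_nsmul ℂ, smul_smul, smul_smul]
  congr 1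
  ring

/-- With `z̄` frozen as a parameter, `∂ - 2π z̄` is the conjugate of `∂` by an exponential. This
form makes the covariance under twisting a computation with exponents. -/
lemma truePoly_eq_exp_smul [CompleteSpace E] (j : ℕ) {H : ℂ → E}
    (hH : Differentiable ℂ H) (z : ℂ) :
    truePoly j H z = Complex.exp (2 * Real.pi * star z * z) •
      iteratedDeriv j (fun w => Complex.exp (-(2 * Real.pi) * star z * w) • H w) z := by
  have e : 2 * Real.pi * star z * z + -(2 * Real.pi) * star z * z = 0 := by ring
  rw [iteratedDeriv_exp_smul j _ hH, smul_smul, ← Complex.exp_add, e, Complex.exp_zero, one_smul,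
    truePoly]

/-- The twisted translation by `a` of a function on `ℂ`. -/
def twist (a : ℂ) (H : ℂ → E) (w : ℂ) : E :=
  Complex.exp (-(2 * Real.pi) * star a * w) • H (a + w)

lemma differentiable_twist (a : ℂ) {H : ℂ → E} (hH : Differentiable ℂ H) :
    Differentiable ℂ (twist a H) := by
  unfold twist
  fun_prop

lemma truePoly_twist [CompleteSpace E] (j : ℕ) (a : ℂ) {H : ℂ → E}
    (hH : Differentiable ℂ H) (w : ℂ) :
    truePoly j (twist a H) w = twist a (truePoly j H) w := by
  rw [truePoly_eq_exp_smul j (differentiable_twist a hH), twist, truePoly_eq_exp_smul j hH]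
  -- The exponents `-2π w̄ v` and `-2π ā v` merge into `-2π (a + w)̄ v`; recentring at `a + v`
  -- produces the constant factor.
  have e : (fun v => Complex.exp (-(2 * Real.pi) * star w * v) • twist a H v) =
      fun v => Complex.exp (2 * Real.pi * star (a + w) * a) •
        (fun u => Complex.exp (-(2 * Real.pi) * star (a + w) * u) • H u) (a + v) := by
    funext v
    simp only [twist, smul_smul, ← Complex.exp_add]
    congr 2
    rw [star_add]
    ring
  rw [e, iteratedDeriv_fun_const_smul_field,
    congrFun (iteratedDeriv_comp_const_add j
      (fun u => Complex.exp (-(2 * Real.pi) * star (a + w) * u) • H u) a) w, smul_smul, smul_smul,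
    ← Complex.exp_add, ← Complex.exp_add]
  congr 2
  rw [star_add]
  ring

lemma truePoly_zero_right (j : ℕ) (H : ℂ → E) : truePoly j H 0 = iteratedDeriv j H 0 := by
  rw [truePoly, sum_eq_single 0]
  · simp
  · intro i _ hi; simp [hi]
  · simp

lemma continuous_truePoly [CompleteSpace E] (j : ℕ) {H : ℂ → E} (hH : Differentiable ℂ H) :
    Continuous (truePoly j H) := by
  unfold truePoly
  refine continuous_finsetSum _ fun i _ => ?_
  have h2 : ContDiff ℂ ω H := hH.contDiff
  have := h2.continuous_iteratedDeriv (j - i) (by simp)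
  fun_prop

/-! ### Circle averages -/

open Real in
/-- The circle average of `w̄^i F(w)` for an entire function `F`. -/
lemma circleAverage_star_pow_smul [CompleteSpace E] {r : ℝ} (hr : 0 < r) (i : ℕ) {F : ℂ → E}
    (hF : Differentiable ℂ F) :
    circleAverage (fun w => (star w) ^ i • F w) 0 r =
      (((r ^ 2 : ℝ) : ℂ) ^ i / i.factorial) • iteratedDeriv i F 0 := by
  have h := hF.differentiableOn.circleIntegral_one_div_sub_center_pow_smul (c := 0) hr i
  rw [circleAverage_eq_circleIntegral hr.ne']
  -- On the circle `z̄ = r² / z`, which turns the integral into Cauchy's formula for the `i`-th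
  -- derivative.
  have e : (∮ z in C(0, r), (z - 0)⁻¹ • (star z) ^ i • F z) =
      ∮ z in C(0, r), ((r ^ 2 : ℝ) : ℂ) ^ i • (1 / (z - 0) ^ (i + 1)) • F z := by
    refine circleIntegral.integral_congr hr.le fun z hz => ?_
    have hz' : ‖z‖ = r := by simpa using hz
    have hz0 : z ≠ 0 := by
      rintro rfl; simp at hz'; exact hr.ne hz'
    have hzz : z * star z = ((r ^ 2 : ℝ) : ℂ) := by
      rw [← hz']
      simpa using Complex.mul_conj' z
    simp only [smul_smul, sub_zero]
    congr 1
    rw [← hzz, mul_pow]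
    field_simp
    ring
  rw [e, circleIntegral.integral_smul, h, smul_smul, smul_smul]
  congr 1
  field_simp

/-- The polynomial `p_j` such that the average of `(∂ - 2π w̄)^j F` over the circle of radius `r`
around `0` is `p_j (r²) F^{(j)}(0)`. -/
def averagePoly (j : ℕ) (t : ℂ) : ℂ :=
  ∑ i ∈ range (j + 1), ((j.choose i : ℂ) * (-(2 * Real.pi)) ^ i / i.factorial) * t ^ i

-- The term `w̄^i F^{(j-i)}` averages to `r^{2i} / i!` times `F^{(j)}(0)`: the orders always add up
-- to `j`, so only the scalar depends on `r`.
open Real in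
lemma circleAverage_truePoly [CompleteSpace E] {r : ℝ} (hr : 0 < r) (j : ℕ) {F : ℂ → E}
    (hF : Differentiable ℂ F) :
    circleAverage (truePoly j F) 0 r = averagePoly j ((r ^ 2 : ℝ) : ℂ) • truePoly j F 0 := by
  have hd : ∀ k, Differentiable ℂ (iteratedDeriv k F) := fun k =>
    (hF.contDiff (n := ω)).differentiable_iteratedDeriv k (by simp)
  have e : truePoly j F = fun z => ∑ i ∈ range (j + 1),
      (((j.choose i : ℂ) * (-(2 * Real.pi)) ^ i) •
        fun w => (star w) ^ i • iteratedDeriv (j - i) F w) z := by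
    funext z
    refine sum_congr rfl fun i _ => ?_
    simp only [Pi.smul_apply, smul_smul]
    congr 1
    ring
  have hc : ∀ i, Continuous (fun w : ℂ => (star w) ^ i • iteratedDeriv (j - i) F w) := fun i => by
    have := (hd (j - i)).continuous
    fun_prop
  rw [truePoly_zero_right, e, circleAverage_fun_sum
    (fun i _ => ((hc i).const_smul _).continuousOn.circleIntegrable'), averagePoly, sum_smul]
  refine sum_congr rfl fun i hi => ?_
  rw [circleAverage_smul, circleAverage_star_pow_smul hr i (hd _), smul_smul]
  congr 1
  · ring
  · rw [iteratedDeriv_eq_iterate, iteratedDeriv_eq_iterate, iteratedDeriv_eq_iterate,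
      ← Function.iterate_add_apply, Nat.add_sub_cancel' (by simpa [Nat.lt_succ_iff] using hi)]

-- A mean value property about any centre: twisting moves `a` to the origin, where the twisting
-- factor equals `1`.
open Real in
lemma circleAverage_twist_truePoly [CompleteSpace E] {r : ℝ} (hr : 0 < r) (j : ℕ) {H : ℂ → E}
    (hH : Differentiable ℂ H) (a : ℂ) :
    circleAverage (twist a (truePoly j H)) 0 r =
      averagePoly j ((r ^ 2 : ℝ) : ℂ) • truePoly j H a := by
  rw [← funext (truePoly_twist j a hH), circleAverage_truePoly hr j (differentiable_twist a hH),
    truePoly_twist j a hH]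
  simp [twist]

/-! ### Finite differences isolate the top component -/

lemma sum_alternating_averagePoly_of_lt {j n : ℕ} (h : j < n) :
    ∑ k ∈ range (n + 1), ((-1 : ℂ) ^ (n - k) * n.choose k) * averagePoly j (1 + k) = 0 := by
  -- The sum is an `n`-th forward difference of a polynomial of degree `j < n`. Starting at `1`
  -- rather than `0` keeps all the radii `√(1 + k)` positive.
  have h1 : (fwdDiff (1 : ℂ))^[n] (averagePoly j) 1 = 0 := by
    have e : averagePoly j = ∑ i ∈ range (j + 1),
        ((j.choose i : ℂ) * (-(2 * Real.pi)) ^ i / i.factorial) • fun t : ℂ => t ^ i := by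
      funext t
      simp [averagePoly]
    rw [e, fwdDiff_iter_finsetSum, Finset.sum_apply]
    refine sum_eq_zero fun i hi => ?_
    rw [fwdDiff_iter_const_smul, fwdDiff_iter_pow_eq_zero_of_lt (by have := mem_range.1 hi; lia)]
    simp
  rw [fwdDiff_iter_eq_sum_shift] at h1
  simpa using h1

lemma sum_alternating_averagePoly_self (n : ℕ) :
    ∑ k ∈ range (n + 1), ((-1 : ℂ) ^ (n - k) * n.choose k) * averagePoly n (1 + k) =
      (-(2 * Real.pi)) ^ n := by
  -- The leading coefficient `(-2π)^n / n!` meets the `n`-th difference `n!` of `t^n`.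
  have h1 : (fwdDiff (1 : ℂ))^[n] (averagePoly n) 1 = (-(2 * Real.pi)) ^ n := by
    have e : averagePoly n = ∑ i ∈ range (n + 1),
        ((n.choose i : ℂ) * (-(2 * Real.pi)) ^ i / i.factorial) • fun t : ℂ => t ^ i := by
      funext t
      simp [averagePoly]
    rw [e, fwdDiff_iter_finsetSum, Finset.sum_apply, sum_range_succ, sum_eq_zero, zero_add,
      fwdDiff_iter_const_smul, fwdDiff_iter_eq_factorial]
    · have : (n.factorial : ℂ) ≠ 0 := by exact_mod_cast n.factorial_ne_zero
      simp
      field_simp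
    · intro i hi
      rw [fwdDiff_iter_const_smul, fwdDiff_iter_pow_eq_zero_of_lt (mem_range.1 hi)]
      simp
  rw [fwdDiff_iter_eq_sum_shift] at h1
  simpa using h1

lemma twist_sum {ι : Type*} (s : Finset ι) (a : ℂ) (g : ι → ℂ → E) :
    twist a (fun z => ∑ i ∈ s, g i z) = fun w => ∑ i ∈ s, twist a (g i) w := by
  funext w
  simp only [twist, smul_sum]

lemma continuous_twist (a : ℂ) {g : ℂ → E} (hg : Continuous g) : Continuous (twist a g) := by
  unfold twist
  fun_prop

open Real in
/-- The component of highest order of `∑ (∂ - 2π z̄)^j H_j`, recovered from twisted circle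
averages. -/
lemma sum_circleAverage_twist [CompleteSpace E] (n : ℕ) {H : ℕ → ℂ → E}
    (hH : ∀ j, Differentiable ℂ (H j)) (a : ℂ) :
    ∑ k ∈ range (n + 1), ((-1 : ℂ) ^ (n - k) * n.choose k) •
        circleAverage (twist a fun z => ∑ j ∈ range (n + 1), truePoly j (H j) z) 0 √(1 + k) =
      ((-(2 * π)) ^ n : ℂ) • truePoly n (H n) a := by
  have h1 : ∀ k : ℕ,
      circleAverage (twist a fun z => ∑ j ∈ range (n + 1), truePoly j (H j) z) 0 √(1 + k) =
      ∑ j ∈ range (n + 1), averagePoly j (1 + k) • truePoly j (H j) a := by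
    intro k
    rw [twist_sum, circleAverage_fun_sum fun j _ =>
      (continuous_twist a (continuous_truePoly j (hH j))).continuousOn.circleIntegrable']
    refine sum_congr rfl fun j _ => ?_
    rw [circleAverage_twist_truePoly (by positivity) j (hH j), Real.sq_sqrt (by positivity)]
    simp
  simp only [h1, smul_sum, smul_smul]
  rw [sum_comm]
  simp only [← sum_smul]
  rw [sum_range_succ, sum_alternating_averagePoly_self, sum_eq_zero, zero_add]
  intro j hj
  rw [sum_alternating_averagePoly_of_lt (mem_range.1 hj), zero_smul]

/-! ### Gaussian `L²` estimates for twisted circle averages -/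

open scoped ENNReal

lemma lintegral_sq_le {α : Type*} [MeasurableSpace α] (μ : Measure α) {φ : α → ℝ≥0∞}
    (hφ : AEMeasurable φ μ) : (∫⁻ x, φ x ∂μ) ^ 2 ≤ μ Set.univ * ∫⁻ x, φ x ^ 2 ∂μ := by
  have h := ENNReal.lintegral_mul_le_Lp_mul_Lq μ Real.HolderConjugate.two_two
    (aemeasurable_const (b := 1)) hφ
  simp only [Pi.mul_apply, one_mul, lintegral_const, ENNReal.rpow_two] at h
  have h2 := pow_le_pow_left₀ zero_le h 2
  rw [mul_pow, ← ENNReal.rpow_two, ← ENNReal.rpow_two (_ ^ (1 / 2 : ℝ)),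
    ← ENNReal.rpow_mul, ← ENNReal.rpow_two (_ ^ (1 / 2 : ℝ)), ← ENNReal.rpow_mul] at h2
  simpa using h2

/-- The density `|g(z)|² exp(-2π|z|²)`. -/
def fockDensity (g : ℂ → E) (z : ℂ) : ℝ≥0∞ :=
  ‖g z‖ₑ ^ 2 * ENNReal.ofReal (Real.exp (-(2 * Real.pi * ‖z‖ ^ 2)))

omit [NormedSpace ℂ E] in
lemma measurable_fockDensity {g : ℂ → E} (hg : Continuous g) : Measurable (fockDensity g) := by
  unfold fockDensity
  have : Continuous fun z : ℂ => Real.exp (-(2 * Real.pi * ‖z‖ ^ 2)) := by fun_prop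
  exact (hg.enorm.measurable.pow_const 2).mul this.measurable.ennreal_ofReal

/-- The twisting factor absorbs exactly the cross term in `|a + w|² = |a|² + |w|² + 2 Re(ā w)`. -/
lemma enorm_twist_sq_mul (a w : ℂ) (g : ℂ → E) :
    ‖twist a g w‖ₑ ^ 2 * ENNReal.ofReal (Real.exp (-(2 * Real.pi * ‖a‖ ^ 2))) =
      ENNReal.ofReal (Real.exp (2 * Real.pi * ‖w‖ ^ 2)) * fockDensity g (a + w) := by
  have h : ‖twist a g w‖ ^ 2 * Real.exp (-(2 * Real.pi * ‖a‖ ^ 2)) =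
      Real.exp (2 * Real.pi * ‖w‖ ^ 2) * (‖g (a + w)‖ ^ 2 *
        Real.exp (-(2 * Real.pi * ‖a + w‖ ^ 2))) := by
    rw [twist, norm_smul, mul_pow, Complex.norm_exp, ← Real.exp_nat_mul]
    have : ‖a + w‖ ^ 2 = ‖a‖ ^ 2 + ‖w‖ ^ 2 + 2 * (star a * w).re := by
      simp only [Complex.sq_norm, Complex.normSq_apply]
      simp
      ring
    have h2 : (-(2 * Real.pi) * star a * w : ℂ).re = -(2 * Real.pi) * (star a * w).re := by
      rw [mul_assoc, ← Complex.re_ofReal_mul]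
      simp
    rw [this, h2]
    calc _ = ‖g (a + w)‖ ^ 2 * (Real.exp ((2 : ℕ) * (-(2 * Real.pi) * (star a * w).re)) *
          Real.exp (-(2 * Real.pi * ‖a‖ ^ 2))) := by ring
      _ = ‖g (a + w)‖ ^ 2 * (Real.exp (2 * Real.pi * ‖w‖ ^ 2) *
          Real.exp (-(2 * Real.pi * (‖a‖ ^ 2 + ‖w‖ ^ 2 + 2 * (star a * w).re)))) := by
        rw [← Real.exp_add, ← Real.exp_add]
        congr 2
        push_cast
        ring
      _ = _ := by ring
  rw [fockDensity, ← ofReal_norm, ← ofReal_norm,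
    ← ENNReal.ofReal_pow (norm_nonneg _), ← ENNReal.ofReal_pow (norm_nonneg _),
    ← ENNReal.ofReal_mul (by positivity), h, ENNReal.ofReal_mul (by positivity),
    ENNReal.ofReal_mul (by positivity)]

-- Cauchy–Schwarz on the circle; since `|w| = r` is constant there, the leftover Gaussian factor is
-- the constant `e^{2π r²}`.
open Real in
lemma enorm_circleAverage_twist_sq_le (r : ℝ) (a : ℂ) {g : ℂ → E}
    (hg : Continuous g) :
    ‖circleAverage (twist a g) 0 r‖ₑ ^ 2 * ENNReal.ofReal (exp (-(2 * π * ‖a‖ ^ 2))) ≤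
      ENNReal.ofReal (exp (2 * π * r ^ 2)) *
        ∫⁻ θ in Set.Ioc 0 (2 * π), fockDensity g (a + circleMap 0 r θ) := by
  have hc : Continuous fun θ => twist a g (circleMap 0 r θ) :=
    (continuous_twist a hg).comp (continuous_circleMap 0 r)
  have h1 : ‖circleAverage (twist a g) 0 r‖ₑ ^ 2 ≤
      ∫⁻ θ in Set.Ioc 0 (2 * π), ‖twist a g (circleMap 0 r θ)‖ₑ ^ 2 := by
    rw [circleAverage, intervalIntegral.integral_of_le (by positivity), enorm_smul, mul_pow]
    calc _ ≤ ‖(2 * π)⁻¹‖ₑ ^ 2 *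
          (∫⁻ θ in Set.Ioc 0 (2 * π), ‖twist a g (circleMap 0 r θ)‖ₑ) ^ 2 := by
          gcongr
          exact enorm_integral_le_lintegral_enorm _
      _ ≤ ‖(2 * π)⁻¹‖ₑ ^ 2 * (ENNReal.ofReal (2 * π) *
          ∫⁻ θ in Set.Ioc 0 (2 * π), ‖twist a g (circleMap 0 r θ)‖ₑ ^ 2) := by
          gcongr
          refine (lintegral_sq_le _ hc.enorm.measurable.aemeasurable).trans_eq ?_
          simp
      _ ≤ _ := by
          -- What remains is the factor `(2π)⁻² · 2π = (2π)⁻¹ ≤ 1`, which is dropped.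
          rw [← mul_assoc]
          refine mul_le_of_le_one_left zero_le ?_
          rw [Real.enorm_of_nonneg (by positivity), ← ENNReal.ofReal_pow (by positivity),
            ← ENNReal.ofReal_mul (by positivity), ← ENNReal.ofReal_one]
          refine ENNReal.ofReal_le_ofReal ?_
          have : (2 * π)⁻¹ ^ 2 * (2 * π) = (2 * π)⁻¹ := by field_simp
          rw [this]
          exact inv_le_one_of_one_le₀ (by nlinarith [Real.pi_gt_three])
  refine (mul_le_mul_left h1 _).trans_eq ?_
  rw [← lintegral_mul_const _ (hc.enorm.measurable.pow_const 2),
    ← lintegral_const_mul' _ _ ENNReal.ofReal_ne_top]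
  refine lintegral_congr fun θ => ?_
  rw [enorm_twist_sq_mul, norm_circleMap_zero, sq_abs]

-- Tonelli and translation invariance of Lebesgue measure: for each fixed angle the integral in `a`
-- is that of the density itself.
open Real in
omit [NormedSpace ℂ E] in
lemma lintegral_circle_fockDensity (r : ℝ) {g : ℂ → E} (hg : Continuous g) :
    ∫⁻ a, ∫⁻ θ in Set.Ioc 0 (2 * π), fockDensity g (a + circleMap 0 r θ) =
      ENNReal.ofReal (2 * π) * ∫⁻ z, fockDensity g z := by
  have hm : Measurable fun q : ℂ × ℝ => fockDensity g (q.1 + circleMap 0 r q.2) :=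
    (measurable_fockDensity hg).comp
      (measurable_fst.add ((continuous_circleMap 0 r).measurable.comp measurable_snd))
  rw [lintegral_lintegral_swap hm.aemeasurable]
  simp only [lintegral_add_right_eq_self (fockDensity g), lintegral_const]
  simp [mul_comm]

lemma truePoly_eq_zero_of_sum_eq_zero [CompleteSpace E] (n : ℕ) {H : ℕ → ℂ → E}
    (hH : ∀ j, Differentiable ℂ (H j))
    (h0 : ∀ z, ∑ j ∈ range (n + 1), truePoly j (H j) z = 0) (a : ℂ) :
    truePoly n (H n) a = 0 := by
  have h := sum_circleAverage_twist n hH a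
  have e : twist a (fun z => ∑ j ∈ range (n + 1), truePoly j (H j) z) = fun _ => (0 : E) := by
    funext w; simp [twist, h0]
  rw [e] at h
  simp only [Real.circleAverage_const, smul_zero, sum_const_zero] at h
  exact (smul_eq_zero.1 h.symm).resolve_left (pow_ne_zero _ (by simp [Real.pi_ne_zero]))

/-- If `∑_{j ≤ n} (∂ - 2π z̄)^j H_j` lies in the Fock space, so does its component of highest
order. -/
lemma lintegral_fockDensity_truePoly_lt_top [CompleteSpace E] (n : ℕ) {H : ℕ → ℂ → E}
    (hH : ∀ j, Differentiable ℂ (H j))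
    (hfin : ∫⁻ z, fockDensity (fun z => ∑ j ∈ range (n + 1), truePoly j (H j) z) z < ⊤) :
    ∫⁻ z, fockDensity (truePoly n (H n)) z < ⊤ := by
  set g : ℂ → E := fun z => ∑ j ∈ range (n + 1), truePoly j (H j) z with hgdef
  have hg : Continuous g := continuous_finsetSum _ fun j _ => continuous_truePoly j (hH j)
  set c : ℂ := (-(2 * Real.pi)) ^ n with hc
  have hc0 : c ≠ 0 := pow_ne_zero _ (by simp [Real.pi_ne_zero])
  -- The finite-difference weights, normalised so that the top component is reproduced exactly.
  let b : ℕ → ℂ := fun k => c⁻¹ * ((-1 : ℂ) ^ (n - k) * n.choose k)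
  have hrep : ∀ a, truePoly n (H n) a = ∑ k ∈ range (n + 1),
      b k • Real.circleAverage (twist a g) 0 √(1 + k) := by
    intro a
    rw [← inv_smul_smul₀ hc0 (truePoly n (H n) a), ← sum_circleAverage_twist n hH a, smul_sum]
    simp only [b, mul_smul, hgdef]
  let K : ℕ → ℝ≥0∞ := fun k => ‖b k‖ₑ ^ 2 * ENNReal.ofReal (Real.exp (2 * Real.pi * √(1 + k) ^ 2))
  have hK : ∀ k, K k ≠ ⊤ := fun k =>
    ENNReal.mul_ne_top (ENNReal.pow_ne_top enorm_ne_top) ENNReal.ofReal_ne_top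
  have hle : ∀ a, fockDensity (truePoly n (H n)) a ≤ (n + 1 : ℕ) * ∑ k ∈ range (n + 1), K k *
      ∫⁻ θ in Set.Ioc 0 (2 * Real.pi), fockDensity g (a + circleMap 0 √(1 + k) θ) := by
    intro a
    have h1 : ‖truePoly n (H n) a‖ₑ ^ 2 ≤ (n + 1 : ℕ) * ∑ k ∈ range (n + 1),
        (‖b k‖ₑ * ‖Real.circleAverage (twist a g) 0 √(1 + k)‖ₑ) ^ 2 := by
      -- The power mean inequality `(∑ x_k)² ≤ (n + 1) ∑ x_k²` over the `n + 1` radii.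
      have h2 := ENNReal.rpow_sum_le_const_mul_sum_rpow (range (n + 1))
        (fun k => ‖b k‖ₑ * ‖Real.circleAverage (twist a g) 0 √(1 + k)‖ₑ) one_le_two
      norm_num at h2
      rw [hrep]
      refine le_trans ?_ (by simpa using h2)
      gcongr
      exact (enorm_sum_le _ _).trans_eq (sum_congr rfl fun k _ => enorm_smul _ _)
    rw [fockDensity]
    refine (mul_le_mul_left h1 _).trans ?_
    rw [mul_assoc, sum_mul]
    refine mul_le_mul' le_rfl (sum_le_sum fun k _ => ?_)
    simp only [K]
    rw [mul_pow, mul_assoc (‖b k‖ₑ ^ 2), mul_assoc (‖b k‖ₑ ^ 2)]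
    refine mul_le_mul' le_rfl ?_
    exact enorm_circleAverage_twist_sq_le _ a hg
  refine (lintegral_mono hle).trans_lt ?_
  have hm : ∀ k : ℕ, Measurable fun a => K k *
      ∫⁻ θ in Set.Ioc 0 (2 * Real.pi), fockDensity g (a + circleMap 0 √(1 + k) θ) := by
    intro k
    refine Measurable.const_mul (Measurable.lintegral_prod_right' (f := fun q : ℂ × ℝ =>
      fockDensity g (q.1 + circleMap 0 √(1 + k) q.2)) ?_) _
    exact (measurable_fockDensity hg).comp
      (measurable_fst.add ((continuous_circleMap 0 _).measurable.comp measurable_snd))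
  rw [lintegral_const_mul' _ _ (by simp), lintegral_finsetSum _ fun k _ => hm k]
  refine ENNReal.mul_lt_top (by simp) (ENNReal.sum_lt_top.2 fun k _ => ?_)
  rw [lintegral_const_mul' _ _ (hK k), lintegral_circle_fockDensity _ hg]
  exact ENNReal.mul_lt_top (hK k).lt_top (ENNReal.mul_lt_top ENNReal.ofReal_lt_top hfin)

end Complex

/-! ### Slice functions -/

/-- Slice functions `f (x + I y) = α (x, y) + I β (x, y)` whose stem `(α, β)` is of class `C^m`. -/
def IsSlice (m : ℕ∞ω) (f : ℍ → ℍ) : Prop :=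
  ∃ α β : ℝ × ℝ → ℍ,
    (∀ x y : ℝ, α (x, -y) = α (x, y)) ∧ (∀ x y : ℝ, β (x, -y) = -β (x, y)) ∧
    ContDiff ℝ m α ∧ ContDiff ℝ m β ∧
    ∀ I ∈ imagUnits, ∀ p : ℝ × ℝ, f (slicePt I p) = α p + I * β p

lemma isSlicePolyanalytic_iff {n : ℕ} {f : ℍ → ℍ} :
    IsSlicePolyanalytic n f ↔
      IsSlice n f ∧ ∀ I ∈ imagUnits, ∀ p, (dbar I)^[n] (restr f I) p = 0 := by
  constructor
  · rintro ⟨α, β, h1, h2, h3, h4, h5, h6⟩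
    refine ⟨⟨α, β, h1, h2, h3, h4, h5⟩, fun I hI p => ?_⟩
    rw [show restr f I = fun p => α p + I * β p from funext (h5 I hI)]
    exact h6 I hI p
  · rintro ⟨⟨α, β, h1, h2, h3, h4, h5⟩, h6⟩
    refine ⟨α, β, h1, h2, h3, h4, h5, fun I hI p => ?_⟩
    rw [← show restr f I = fun p => α p + I * β p from funext (h5 I hI)]
    exact h6 I hI p

lemma mul_self_imagUnit {I : ℍ} (hI : I ∈ imagUnits) : I * I = -1 := by
  rw [← sq]; exact hI

lemma exists_imagUnit : ∃ I : ℍ, I ∈ imagUnits := by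
  refine ⟨((Complex.I : ℂ) : ℍ), ?_⟩
  change ((Complex.I : ℂ) : ℍ) ^ 2 = -1
  rw [sq, ← Quaternion.coeComplex_mul, Complex.I_mul_I]
  ext <;> simp

/-- Every quaternion is of the form `x + I y`. -/
lemma exists_eq_slicePt (q : ℍ) : ∃ I ∈ imagUnits, ∃ p : ℝ × ℝ, 0 ≤ p.2 ∧ q = slicePt I p := by
  by_cases h : q.im = 0
  · obtain ⟨I, hI⟩ := exists_imagUnit
    refine ⟨I, hI, (q.re, 0), le_rfl, ?_⟩
    rw [slicePt, Quaternion.coe_zero, mul_zero, add_zero]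
    conv_lhs => rw [← q.re_add_im, h, add_zero]
  · have hn : ‖q.im‖ ≠ 0 := norm_ne_zero_iff.2 h
    refine ⟨(‖q.im‖⁻¹ : ℝ) • q.im, ?_, (q.re, ‖q.im‖), norm_nonneg _, ?_⟩
    · change _ ^ 2 = (-1 : ℍ)
      rw [smul_pow, Quaternion.im_sq, Quaternion.normSq_eq_norm_mul_self, smul_neg,
        ← Quaternion.coe_smul, ← Quaternion.coe_one]
      congr 2
      simp only [smul_eq_mul]
      field_simp
    · rw [slicePt, ← Quaternion.coe_commutes, Quaternion.coe_mul_eq_smul, smul_smul,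
        mul_inv_cancel₀ hn, one_smul, q.re_add_im]

lemma slicePt_eq_slicePt {I J : ℍ} (hI : I ∈ imagUnits) (hJ : J ∈ imagUnits) {p r : ℝ × ℝ}
    (h : slicePt I p = slicePt J r) :
    p.1 = r.1 ∧ (p.2 = 0 ∧ r.2 = 0 ∨ I = J ∧ p.2 = r.2 ∨ I = -J ∧ p.2 = -r.2) := by
  have h1 : p.1 = r.1 := by
    have := congrArg QuaternionAlgebra.re h
    simpa [slicePt, re_imagUnit hI, re_imagUnit hJ] using this
  refine ⟨h1, ?_⟩
  have h2 : p.2 • I = r.2 • J := by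
    rw [slicePt, slicePt, h1, add_right_inj, ← Quaternion.coe_commutes, ← Quaternion.coe_commutes,
      Quaternion.coe_mul_eq_smul, Quaternion.coe_mul_eq_smul] at h
    exact h
  have h3 : |p.2| = |r.2| := by
    simpa [norm_smul, norm_imagUnit hI, norm_imagUnit hJ] using congrArg norm h2
  by_cases h0 : r.2 = 0
  · left
    rw [h0, abs_zero, abs_eq_zero] at h3
    exact ⟨h3, h0⟩
  · right
    rcases abs_eq_abs.1 h3 with e | e
    · left
      rw [e] at h2
      exact ⟨smul_right_injective _ h0 h2, e⟩
    · right
      rw [e, neg_smul, ← smul_neg] at h2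
      exact ⟨neg_eq_iff_eq_neg.1 (smul_right_injective _ h0 h2), e⟩

/-- Stem functions of the right parities induce functions on `ℍ`. -/
lemma exists_of_stem {α β : ℝ × ℝ → ℍ} (hα : ∀ x y : ℝ, α (x, -y) = α (x, y))
    (hβ : ∀ x y : ℝ, β (x, -y) = -β (x, y)) :
    ∃ f : ℍ → ℍ, ∀ I ∈ imagUnits, ∀ p : ℝ × ℝ, f (slicePt I p) = α p + I * β p := by
  choose J hJ r _ hr using exists_eq_slicePt
  refine ⟨fun q => α (r q) + J q * β (r q), fun I hI p => ?_⟩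
  obtain ⟨h1, h2⟩ := slicePt_eq_slicePt hI (hJ _) (hr (slicePt I p))
  -- Oddness kills `β` on the real axis, so the arbitrary unit chosen at real points is harmless;
  -- elsewhere the only ambiguity is `(I, y) ↔ (-I, -y)`.
  have hβ0 : ∀ x, β (x, 0) = 0 := fun x => by
    have := hβ x 0
    rw [neg_zero, eq_neg_iff_add_eq_zero, ← two_smul ℝ] at this
    exact (smul_eq_zero.1 this).resolve_left two_ne_zero
  change α (r (slicePt I p)) + J (slicePt I p) * β (r (slicePt I p)) = _
  generalize r (slicePt I p) = s at *
  generalize J (slicePt I p) = K at *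
  obtain ⟨x, y⟩ := p
  obtain ⟨x', y'⟩ := s
  simp only at h1 h2 ⊢
  subst h1
  rcases h2 with ⟨rfl, rfl⟩ | ⟨rfl, rfl⟩ | ⟨rfl, rfl⟩
  · simp [hβ0]
  · rfl
  · rw [hα, hβ, neg_mul_neg]

namespace IsSlice

variable {m : ℕ∞ω} {f g : ℍ → ℍ}

lemma of_le {k : ℕ∞ω} (hf : IsSlice m f) (h : k ≤ m) : IsSlice k f := by
  obtain ⟨α, β, h1, h2, h3, h4, h5⟩ := hf
  exact ⟨α, β, h1, h2, h3.of_le h, h4.of_le h, h5⟩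

lemma add (hf : IsSlice m f) (hg : IsSlice m g) : IsSlice m (fun q => f q + g q) := by
  obtain ⟨α, β, h1, h2, h3, h4, h5⟩ := hf
  obtain ⟨γ, δ, k1, k2, k3, k4, k5⟩ := hg
  refine ⟨fun p => α p + γ p, fun p => β p + δ p, fun x y => by simp only [h1, k1],
    fun x y => by simp only [h2, k2, neg_add], h3.add k3, h4.add k4, fun I hI p => ?_⟩
  simp only [h5 I hI, k5 I hI, mul_add]; abel

lemma zero : IsSlice m (fun _ => 0) :=
  ⟨fun _ => 0, fun _ => 0, by simp, by simp, contDiff_const, contDiff_const, by simp⟩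

lemma sum {ι : Type*} (s : Finset ι) {f : ι → ℍ → ℍ} (hf : ∀ i ∈ s, IsSlice m (f i)) :
    IsSlice m (fun q => ∑ i ∈ s, f i q) := by
  classical
  induction s using Finset.induction_on with
  | empty => simpa using zero
  | insert i s hi ih =>
    simp only [Finset.sum_insert hi]
    exact (hf i (by simp)).add (ih fun j hj => hf j (by simp [hj]))

lemma smul (hf : IsSlice m f) (c : ℝ) : IsSlice m (fun q => c • f q) := by
  obtain ⟨α, β, h1, h2, h3, h4, h5⟩ := hf
  refine ⟨fun p => c • α p, fun p => c • β p, fun x y => by simp only [h1],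
    fun x y => by simp only [h2, smul_neg], h3.const_smul c, h4.const_smul c, fun I hI p => ?_⟩
  simp only [h5 I hI, smul_add, mul_smul_comm]

lemma contDiff_restr (hf : IsSlice m f) {I : ℍ} (hI : I ∈ imagUnits) :
    ContDiff ℝ m (restr f I) := by
  obtain ⟨α, β, -, -, h3, h4, h5⟩ := hf
  rw [show restr f I = fun p => α p + I * β p from funext (h5 I hI)]
  exact h3.add (contDiff_const.mul h4)

lemma ext_restr (h : ∀ I ∈ imagUnits, ∀ p, restr f I p = restr g I p) : f = g := by
  funext q
  obtain ⟨I, hI, p, -, rfl⟩ := exists_eq_slicePt q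
  exact h I hI p

/-- The stem of a slice function is determined by the values on one slice. -/
lemma of_contDiff_restr {k : ℕ∞ω} (hf : IsSlice m f) {I : ℍ} (hI : I ∈ imagUnits)
    (h : ContDiff ℝ k (restr f I)) : IsSlice k f := by
  obtain ⟨α, β, h1, h2, -, -, h5⟩ := hf
  have hf : ∀ p, restr f I p = α p + I * β p := h5 I hI
  have hc : ContDiff ℝ k (fun p : ℝ × ℝ => restr f I (p.1, -p.2)) := h.comp (by fun_prop)
  -- `α` and `I β` are the even and odd parts in `y` of the restriction.
  have hα : α = fun p => (1 / 2 : ℝ) • (restr f I p + restr f I (p.1, -p.2)) := by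
    funext ⟨x, y⟩
    simp only [hf, h1, h2, mul_neg]
    module
  have hβ : β = fun p => (1 / 2 : ℝ) • (I * (restr f I (p.1, -p.2) - restr f I p)) := by
    funext ⟨x, y⟩
    simp only [hf, h1, h2]
    have : α (x, y) + I * -β (x, y) - (α (x, y) + I * β (x, y)) = I * ((-2 : ℝ) • β (x, y)) := by
      rw [mul_neg, mul_smul_comm]; module
    rw [this, ← mul_assoc, mul_self_imagUnit hI, neg_one_mul]
    module
  refine ⟨α, β, h1, h2, ?_, ?_, h5⟩
  · rw [hα]
    exact (h.add hc).const_smul _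
  · rw [hβ]
    exact (contDiff_const.mul (hc.sub h)).const_smul _

/-- Quantitative representation formula: both stem components are read off from the slice `ℂ_I` at a
point and its conjugate. -/
lemma norm_restr_le (hf : IsSlice m f) {I J : ℍ} (hI : I ∈ imagUnits) (hJ : J ∈ imagUnits)
    (p : ℝ × ℝ) : ‖restr f J p‖ ≤ ‖restr f I p‖ + ‖restr f I (p.1, -p.2)‖ := by
  obtain ⟨α, β, h1, h2, -, -, h5⟩ := hf
  have hfI : ∀ p, restr f I p = α p + I * β p := h5 I hI
  have hfJ : ∀ p, restr f J p = α p + J * β p := h5 J hJ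
  obtain ⟨x, y⟩ := p
  have hα : (2 : ℝ) * ‖α (x, y)‖ ≤ ‖restr f I (x, y)‖ + ‖restr f I (x, -y)‖ := by
    have : (2 : ℝ) • α (x, y) = restr f I (x, y) + restr f I (x, -y) := by
      simp only [hfI, h1, h2, mul_neg]; module
    rw [← Real.norm_two, ← norm_smul, this]
    exact norm_add_le _ _
  have hβ : (2 : ℝ) * ‖β (x, y)‖ ≤ ‖restr f I (x, y)‖ + ‖restr f I (x, -y)‖ := by
    have : (2 : ℝ) • (I * β (x, y)) = restr f I (x, y) - restr f I (x, -y) := by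
      simp only [hfI, h1, h2, mul_neg]; module
    have hn : ‖β (x, y)‖ = ‖I * β (x, y)‖ := by rw [norm_mul, norm_imagUnit hI, one_mul]
    rw [hn, ← Real.norm_two, ← norm_smul, this]
    exact norm_sub_le _ _
  rw [hfJ]
  have := norm_add_le (α (x, y)) (J * β (x, y))
  rw [norm_mul, norm_imagUnit hJ, one_mul] at this
  simp only at *
  linarith

/-- The scalar `c` serves even stems (`c = 1`) and odd stems (`c = -1`) at once. -/
lemma fderiv_even {α : ℝ × ℝ → ℍ} (hd : Differentiable ℝ α) {c : ℝ}
    (h : ∀ x y : ℝ, α (x, -y) = c • α (x, y)) (x y : ℝ) :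
    fderiv ℝ α (x, -y) (1, 0) = c • fderiv ℝ α (x, y) (1, 0) ∧
      fderiv ℝ α (x, -y) (0, 1) = -(c • fderiv ℝ α (x, y) (0, 1)) := by
  let L : ℝ × ℝ →L[ℝ] ℝ × ℝ :=
    (ContinuousLinearMap.fst ℝ ℝ ℝ).prod (-ContinuousLinearMap.snd ℝ ℝ ℝ)
  have e : α ∘ L = fun p => c • α p := funext fun p => h p.1 p.2
  have h1 : HasFDerivAt (α ∘ L) ((fderiv ℝ α (x, -y)).comp L) (x, y) :=
    HasFDerivAt.comp (x, y) (hd (L (x, y))).hasFDerivAt L.hasFDerivAt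
  have h2 : HasFDerivAt (fun p => c • α p) (c • fderiv ℝ α (x, y)) (x, y) :=
    (hd _).hasFDerivAt.const_smul c
  rw [e] at h1
  have h3 := h1.unique h2
  constructor
  · simpa [L] using DFunLike.congr_fun h3 (1, 0)
  · have h4 := DFunLike.congr_fun h3 (0, -1)
    have e1 : ((0, -1) : ℝ × ℝ) = -(0, 1) := by simp
    have e2 : L (0, -1) = (0, 1) := by simp [L]
    rw [ContinuousLinearMap.comp_apply, e2, e1, map_neg] at h4
    exact h4

end IsSlice

lemma fderiv_add_mul {α β : ℝ × ℝ → ℍ} (hα : Differentiable ℝ α) (hβ : Differentiable ℝ β)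
    (I : ℍ) (p v : ℝ × ℝ) :
    fderiv ℝ (fun p => α p + I * β p) p v = fderiv ℝ α p v + I * fderiv ℝ β p v := by
  have h : HasFDerivAt (fun p => α p + I * β p) (fderiv ℝ α p + I • fderiv ℝ β p) p :=
    (hα p).hasFDerivAt.add ((hβ p).hasFDerivAt.const_mul I)
  rw [h.fderiv]
  simp

namespace IsSlice

/-- The stem `½(α_x - β_y)`, `½(β_x + α_y)` is independent of `I` and has the right parities, so the
slicewise `∂̄` glue to one function on `ℍ`. -/
lemma exists_dbar {m : ℕ} {f : ℍ → ℍ} (hf : IsSlice (m + 1 : ℕ) f) :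
    ∃ g, IsSlice m g ∧ ∀ I ∈ imagUnits, restr g I = dbar I (restr f I) := by
  obtain ⟨α, β, h1, h2, h3, h4, h5⟩ := hf
  have dα : Differentiable ℝ α := differentiable_of_succ h3
  have dβ : Differentiable ℝ β := differentiable_of_succ h4
  have eα := fderiv_even dα (c := 1) (by simpa using h1)
  have eβ := fderiv_even dβ (c := -1) (by simpa using h2)
  simp only [one_smul] at eα
  simp only [neg_one_smul, neg_neg] at eβ
  have cα : ContDiff ℝ m (fderiv ℝ α) := h3.fderiv_right (by norm_cast)
  have cβ : ContDiff ℝ m (fderiv ℝ β) := h4.fderiv_right (by norm_cast)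
  let γ : ℝ × ℝ → ℍ := fun p => (1 / 2 : ℝ) • (fderiv ℝ α p (1, 0) - fderiv ℝ β p (0, 1))
  let δ : ℝ × ℝ → ℍ := fun p => (1 / 2 : ℝ) • (fderiv ℝ β p (1, 0) + fderiv ℝ α p (0, 1))
  have hγ : ∀ x y, γ (x, -y) = γ (x, y) := fun x y => by
    simp only [γ, (eα x y).1, (eβ x y).2]
  have hδ : ∀ x y, δ (x, -y) = -δ (x, y) := fun x y => by
    simp only [δ, (eα x y).2, (eβ x y).1]; module
  obtain ⟨g, hg⟩ := exists_of_stem hγ hδ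
  refine ⟨g, ⟨γ, δ, hγ, hδ, ?_, ?_, hg⟩, fun I hI => ?_⟩
  · exact ((cα.clm_apply contDiff_const).sub (cβ.clm_apply contDiff_const)).const_smul _
  · exact ((cβ.clm_apply contDiff_const).add (cα.clm_apply contDiff_const)).const_smul _
  · rw [show restr f I = fun p => α p + I * β p from funext (h5 I hI)]
    funext p
    rw [show restr g I p = γ p + I * δ p from hg I hI p]
    simp only [dbar, fderiv_add_mul dα dβ, γ, δ, mul_smul_comm, mul_add, ← mul_assoc,
      mul_self_imagUnit hI, neg_one_mul]
    module

lemma exists_dbar_iterate {m : ℕ} (n : ℕ) {f : ℍ → ℍ} (hf : IsSlice (m + n : ℕ) f) :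
    ∃ g, IsSlice m g ∧ ∀ I ∈ imagUnits, restr g I = (dbar I)^[n] (restr f I) := by
  induction n generalizing f with
  | zero => exact ⟨f, hf, fun _ _ => rfl⟩
  | succ n ih =>
    obtain ⟨f₁, h1, h2⟩ := exists_dbar (m := m + n) hf
    obtain ⟨g, h3, h4⟩ := ih h1
    refine ⟨g, h3, fun I hI => ?_⟩
    rw [h4 I hI, h2 I hI, Function.iterate_succ_apply]

end IsSlice

/-! ### The slice derivative -/

/-- The derivative of `f` in the real direction, which on slice regular functions is the slice
derivative. -/
def sderiv (f : ℍ → ℍ) (q : ℍ) : ℍ := deriv (fun t : ℝ => f (q + t)) 0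

lemma restr_sderiv {f : ℍ → ℍ} {I : ℍ} (h : Differentiable ℝ (restr f I)) :
    restr (sderiv f) I = fun p => fderiv ℝ (restr f I) p (1, 0) := by
  funext p
  have h1 : HasDerivAt (fun t : ℝ => p + t • ((1, 0) : ℝ × ℝ)) (1, 0) 0 := by
    simpa using ((hasDerivAt_id (0 : ℝ)).smul_const ((1, 0) : ℝ × ℝ)).const_add p
  have h2 : HasFDerivAt (restr f I) (fderiv ℝ (restr f I) p) (p + (0 : ℝ) • ((1, 0) : ℝ × ℝ)) := by
    simpa using (h p).hasFDerivAt
  have h3 := h2.comp_hasDerivAt (0 : ℝ) h1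
  have e : (restr f I ∘ fun t : ℝ => p + t • ((1, 0) : ℝ × ℝ)) =
      fun t : ℝ => f (slicePt I p + t) := by
    funext t
    simp only [Function.comp, restr, slicePt]
    simp
    congr 1
    abel
  rw [e] at h3
  exact h3.deriv

lemma dbar_eq_zero_iff {I : ℍ} (hI : I ∈ imagUnits) {g : ℝ × ℝ → ℍ} {p : ℝ × ℝ} :
    dbar I g p = 0 ↔ fderiv ℝ g p (0, 1) = I * fderiv ℝ g p (1, 0) := by
  have hII := mul_self_imagUnit hI
  rw [dbar, smul_eq_zero, or_iff_right (by norm_num)]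
  constructor
  · intro h
    have h2 : I * (fderiv ℝ g p (1, 0) + I * fderiv ℝ g p (0, 1)) = 0 := by rw [h, mul_zero]
    rw [mul_add, ← mul_assoc, hII, neg_one_mul, ← sub_eq_add_neg, sub_eq_zero] at h2
    exact h2.symm
  · intro h
    rw [h, ← mul_assoc, hII, neg_one_mul, add_neg_cancel]

/-- Holomorphy upgrades a `C^1` stem to a smooth one: a single slice restriction is smooth and
recovers the stem. -/
lemma isSliceRegular_iff {f : ℍ → ℍ} :
    IsSliceRegular f ↔ IsSlice ∞ f ∧ ∀ I ∈ imagUnits, ∀ p, dbar I (restr f I) p = 0 := by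
  constructor
  · intro h
    obtain ⟨h1, h2⟩ := isSlicePolyanalytic_iff.1 h
    obtain ⟨I, hI⟩ := exists_imagUnit
    exact ⟨h1.of_contDiff_restr hI (h.contDiff_restr hI), h2⟩
  · rintro ⟨h1, h2⟩
    exact isSlicePolyanalytic_iff.2 ⟨h1.of_le (by simp), h2⟩

lemma IsSliceRegular.differentiable_restr {f : ℍ → ℍ} (hf : IsSliceRegular f) {I : ℍ}
    (hI : I ∈ imagUnits) : Differentiable ℝ (restr f I) :=
  (hf.contDiff_restr hI).differentiable (by simp)

lemma IsSlice.sderiv {f : ℍ → ℍ} (hf : IsSlice ∞ f) : IsSlice ∞ (sderiv f) := by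
  obtain ⟨α, β, h1, h2, h3, h4, h5⟩ := hf
  have dα : Differentiable ℝ α := h3.differentiable (by simp)
  have dβ : Differentiable ℝ β := h4.differentiable (by simp)
  have eα := fderiv_even dα (c := 1) (by simpa using h1)
  have eβ := fderiv_even dβ (c := -1) (by simpa using h2)
  have cα : ContDiff ℝ ∞ (fderiv ℝ α) := h3.fderiv_right (by norm_cast)
  have cβ : ContDiff ℝ ∞ (fderiv ℝ β) := h4.fderiv_right (by norm_cast)
  refine ⟨fun p => fderiv ℝ α p (1, 0), fun p => fderiv ℝ β p (1, 0),
    fun x y => by simpa using (eα x y).1, fun x y => by simpa using (eβ x y).1,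
    cα.clm_apply contDiff_const, cβ.clm_apply contDiff_const, fun I hI p => ?_⟩
  have e : restr f I = fun p => α p + I * β p := funext (h5 I hI)
  have hd : Differentiable ℝ (restr f I) := by
    rw [e]; exact dα.add (dβ.const_mul I)
  rw [← fderiv_add_mul dα dβ, ← e]
  exact congrFun (restr_sderiv hd) p

lemma IsSliceRegular.sderiv {f : ℍ → ℍ} (hf : IsSliceRegular f) : IsSliceRegular (sderiv f) := by
  obtain ⟨h1, h2⟩ := isSliceRegular_iff.1 hf
  refine isSliceRegular_iff.2 ⟨h1.sderiv, fun I hI p => ?_⟩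
  have hs := hf.contDiff_restr hI
  have hd := hf.differentiable_restr hI
  have hs' : ContDiff ℝ ∞ (fderiv ℝ (restr f I)) := hs.fderiv_right (by norm_cast)
  have hd' : Differentiable ℝ (fderiv ℝ (restr f I)) := hs'.differentiable (by simp)
  have hv : ∀ v w : ℝ × ℝ, fderiv ℝ (fun p => fderiv ℝ (restr f I) p v) p w =
      fderiv ℝ (fderiv ℝ (restr f I)) p w v := fun v w => by
    have := ((hd' p).hasFDerivAt.clm_apply (hasFDerivAt_const v p)).fderiv
    rw [this]
    simp
  rw [restr_sderiv hd, dbar_eq_zero_iff hI]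
  have hsym : IsSymmSndFDerivAt ℝ (restr f I) p :=
    hs.contDiffAt.isSymmSndFDerivAt (by
    simpa using WithTop.coe_le_coe.2 (le_top : (2 : ℕ∞) ≤ ⊤))
  -- Symmetry of second derivatives lets `∂_x` pass through the Cauchy–Riemann equation.
  rw [hv, hv, hsym.eq, ← hv]
  have e : (fun p => fderiv ℝ (restr f I) p (0, 1)) =
      fun p => 0 + I * fderiv ℝ (restr f I) p (1, 0) :=
    funext fun p => by rw [zero_add]; exact (dbar_eq_zero_iff hI).1 (h2 I hI p)
  rw [e, fderiv_add_mul (differentiable_const _) (hd'.clm_apply (differentiable_const _)), hv]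
  simp

lemma IsSliceRegular.sderiv_iterate {f : ℍ → ℍ} (hf : IsSliceRegular f) (k : ℕ) :
    IsSliceRegular (SliceFock.sderiv^[k] f) := by
  induction k with
  | zero => exact hf
  | succ k ih => rw [Function.iterate_succ_apply']; exact ih.sderiv

/-- By Cauchy–Riemann `-I ∂_y = ∂_x`, so `∂_I` is the derivative in the real direction. -/
lemma IsSliceRegular.dslice_restr {f : ℍ → ℍ} (hf : IsSliceRegular f) {I : ℍ}
    (hI : I ∈ imagUnits) : dslice I (restr f I) = restr (SliceFock.sderiv f) I := by
  funext p
  have h := (dbar_eq_zero_iff hI).1 ((isSliceRegular_iff.1 hf).2 I hI p)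
  rw [restr_sderiv (hf.differentiable_restr hI), dslice, h, ← mul_assoc, mul_self_imagUnit hI,
    neg_one_mul]
  module

/-! ### Multiplication by the conjugate variable -/

lemma star_imagUnit {I : ℍ} (hI : I ∈ imagUnits) : star I = -I := by
  rw [Quaternion.star_eq_two_re_sub, re_imagUnit hI]; simp

lemma star_slicePt {I : ℍ} (hI : I ∈ imagUnits) (p : ℝ × ℝ) :
    star (slicePt I p) = p.1 • (1 : ℍ) - p.2 • I := by
  rw [slicePt, star_add, star_mul, star_imagUnit hI, Quaternion.star_coe, Quaternion.star_coe,
    Quaternion.coe_mul_eq_smul, smul_neg, ← sub_eq_add_neg]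
  congr 1
  rw [← mul_one (p.1 : ℍ), Quaternion.coe_mul_eq_smul]

lemma star_slicePt_mul_comm {I : ℍ} (hI : I ∈ imagUnits) (p : ℝ × ℝ) :
    star (slicePt I p) * I = I * star (slicePt I p) := by
  rw [star_slicePt hI, sub_mul, mul_sub]
  simp

lemma fderiv_star_mul {I : ℍ} (hI : I ∈ imagUnits) {g : ℝ × ℝ → ℍ} (hg : Differentiable ℝ g)
    (p v : ℝ × ℝ) :
    fderiv ℝ (fun p => star (slicePt I p) * g p) p v =
      star (slicePt I p) * fderiv ℝ g p v + (v.1 • (1 : ℍ) - v.2 • I) * g p := by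
  have h1 : HasFDerivAt (fun p : ℝ × ℝ => p.1 • (1 : ℍ) - p.2 • I)
      ((ContinuousLinearMap.fst ℝ ℝ ℝ).smulRight (1 : ℍ) -
        (ContinuousLinearMap.snd ℝ ℝ ℝ).smulRight I) p :=
    (hasFDerivAt_fst.smul_const 1).sub (hasFDerivAt_snd.smul_const I)
  have h2 := h1.mul' (hg p).hasFDerivAt
  simp only [star_slicePt hI]
  refine (DFunLike.congr_fun h2.fderiv v).trans ?_
  simp

/-- The Leibniz rule survives noncommutativity because `q̄` lies in `ℂ_I` and commutes with `I`;
moreover `∂̄ q̄ = 1`. -/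
lemma dbar_star_mul {I : ℍ} (hI : I ∈ imagUnits) {g : ℝ × ℝ → ℍ} (hg : Differentiable ℝ g) :
    dbar I (fun p => star (slicePt I p) * g p) =
      fun p => g p + star (slicePt I p) * dbar I g p := by
  funext p
  simp only [dbar, fderiv_star_mul hI hg, mul_add, mul_smul_comm, zero_smul, one_smul, sub_zero,
    zero_sub, one_mul, ← mul_assoc, star_slicePt_mul_comm hI, mul_neg, mul_self_imagUnit hI, neg_neg]
  module

lemma dslice_star_mul {I : ℍ} (hI : I ∈ imagUnits) {g : ℝ × ℝ → ℍ} (hg : Differentiable ℝ g) :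
    dslice I (fun p => star (slicePt I p) * g p) =
      fun p => star (slicePt I p) * dslice I g p := by
  funext p
  simp only [dslice, fderiv_star_mul hI hg, mul_add, mul_sub, mul_smul_comm, zero_smul, one_smul,
    sub_zero, zero_sub, one_mul, ← mul_assoc, star_slicePt_mul_comm hI, mul_neg,
    mul_self_imagUnit hI, neg_neg]
  module

lemma contDiff_star_slicePt {I : ℍ} (hI : I ∈ imagUnits) {m : ℕ∞ω} :
    ContDiff ℝ m (fun p => star (slicePt I p)) := by
  simp only [star_slicePt hI]
  fun_prop

lemma IsSlice.star_mul {m : ℕ∞ω} {f : ℍ → ℍ} (hf : IsSlice m f) :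
    IsSlice m (fun q => star q * f q) := by
  obtain ⟨α, β, h1, h2, h3, h4, h5⟩ := hf
  -- The stem comes from expanding `(x - I y)(α + I β)`.
  refine ⟨fun p => p.1 • α p + p.2 • β p, fun p => p.1 • β p - p.2 • α p,
    fun x y => by simp only [h1, h2]; module, fun x y => by simp only [h1, h2]; module,
    by fun_prop, by fun_prop, fun I hI p => ?_⟩
  simp only [h5 I hI, star_slicePt hI, sub_mul, mul_add, mul_sub, smul_mul_assoc, one_mul,
    mul_smul_comm, ← mul_assoc, mul_self_imagUnit hI, neg_one_mul]
  module

lemma IsSlice.star_pow_mul {m : ℕ∞ω} {f : ℍ → ℍ} (hf : IsSlice m f) (i : ℕ) :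
    IsSlice m (fun q => star q ^ i * f q) := by
  induction i with
  | zero => simpa using hf
  | succ i ih =>
    simpa only [pow_succ', mul_assoc] using ih.star_mul

open Finset

lemma dbar_smul {I : ℍ} (c : ℝ) {g : ℝ × ℝ → ℍ} (hg : Differentiable ℝ g) :
    dbar I (fun p => c • g p) = fun p => c • dbar I g p := by
  have h := dbar_mul_right (I := I) hg (c : ℍ)
  simpa only [Quaternion.mul_coe_eq_smul] using h

lemma dbar_iterate_smul {I : ℍ} (n : ℕ) (c : ℝ) {g : ℝ × ℝ → ℍ} (hg : ContDiff ℝ n g) :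
    (dbar I)^[n] (fun p => c • g p) = fun p => c • (dbar I)^[n] g p := by
  have h := dbar_iterate_mul_right (I := I) n (c : ℍ) hg
  simpa only [Quaternion.mul_coe_eq_smul] using h

lemma dbar_iterate_zero (I : ℍ) (n : ℕ) : (dbar I)^[n] (fun _ => 0) = fun _ => 0 := by
  simpa using dbar_iterate_smul (I := I) n 0 (g := fun _ => 0) contDiff_const

lemma dbar_iterate_sum {I : ℍ} {ι : Type*} (n : ℕ) (s : Finset ι) {g : ι → ℝ × ℝ → ℍ}
    (hg : ∀ i ∈ s, ContDiff ℝ n (g i)) :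
    (dbar I)^[n] (fun p => ∑ i ∈ s, g i p) = fun p => ∑ i ∈ s, (dbar I)^[n] (g i) p := by
  classical
  induction s using Finset.induction_on with
  | empty => simpa using dbar_iterate_zero I n
  | insert i s hi ih =>
    simp only [Finset.sum_insert hi]
    rw [dbar_iterate_add n (hg i (by simp)) (ContDiff.sum fun j hj => hg j (by simp [hj])),
      ih fun j hj => hg j (by simp [hj])]

lemma contDiff_star_slicePt_pow_mul {I : ℍ} (hI : I ∈ imagUnits) (i : ℕ) {m : ℕ∞ω}
    {h : ℝ × ℝ → ℍ} (hh : ContDiff ℝ m h) :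
    ContDiff ℝ m (fun p => star (slicePt I p) ^ i * h p) :=
  ((contDiff_star_slicePt hI).pow i).mul hh

lemma dbar_star_pow_mul {I : ℍ} (hI : I ∈ imagUnits) {h : ℝ × ℝ → ℍ} (hh : ContDiff ℝ ∞ h)
    (h0 : ∀ p, dbar I h p = 0) (i : ℕ) :
    dbar I (fun p => star (slicePt I p) ^ i * h p) =
      fun p => (i : ℝ) • (star (slicePt I p) ^ (i - 1) * h p) := by
  induction i with
  | zero => simpa using funext h0
  | succ i ih =>
    have hd : Differentiable ℝ (fun p => star (slicePt I p) ^ i * h p) :=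
      (contDiff_star_slicePt_pow_mul hI i hh).differentiable (by simp)
    simp only [pow_succ', mul_assoc]
    rw [dbar_star_mul hI hd, ih]
    funext p
    rcases i with _ | i
    · simp
    · simp only [mul_smul_comm, ← mul_assoc, ← pow_succ', Nat.add_sub_cancel]
      push_cast
      module

/-- With `∂̄ h = 0`, only the powers of `q̄` are differentiated. For `m > i` the truncated exponent
is harmless, as the coefficient vanishes. -/
lemma dbar_iterate_star_pow_mul {I : ℍ} (hI : I ∈ imagUnits) {h : ℝ × ℝ → ℍ}
    (hh : ContDiff ℝ ∞ h) (h0 : ∀ p, dbar I h p = 0) (i m : ℕ) :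
    (dbar I)^[m] (fun p => star (slicePt I p) ^ i * h p) =
      fun p => (i.descFactorial m : ℝ) • (star (slicePt I p) ^ (i - m) * h p) := by
  induction m with
  | zero => simp
  | succ m ih =>
    rw [Function.iterate_succ_apply', ih,
      dbar_smul _ ((contDiff_star_slicePt_pow_mul hI _ hh).differentiable (by simp)),
      dbar_star_pow_mul hI hh h0]
    funext p
    rw [smul_smul, Nat.descFactorial_succ, Nat.sub_sub]
    push_cast
    rw [mul_comm]

/-! ### The differential operators `(∂_s - 2π q̄)^j` -/

/-- `(∂_s - 2π q̄)^j H` for a slice regular function `H`, expanded by the binomial theorem. -/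
def sliceTruePoly (j : ℕ) (H : ℍ → ℍ) (q : ℍ) : ℍ :=
  ∑ i ∈ range (j + 1), ((j.choose i : ℝ) * (-(2 * Real.pi)) ^ i) •
    (star q ^ i * sderiv^[j - i] H q)

lemma IsSliceRegular.isSlice_sliceTruePoly {H : ℍ → ℍ} (hH : IsSliceRegular H) (j : ℕ) :
    IsSlice ∞ (sliceTruePoly j H) :=
  IsSlice.sum _ fun i _ =>
    (((isSliceRegular_iff.1 (hH.sderiv_iterate (j - i))).1.star_pow_mul i).smul _)

lemma dbar_iterate_restr_sliceTruePoly {H : ℍ → ℍ} (hH : IsSliceRegular H) (j m : ℕ) {I : ℍ}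
    (hI : I ∈ imagUnits) :
    (dbar I)^[m] (restr (sliceTruePoly j H) I) = fun p => ∑ i ∈ range (j + 1),
      ((j.choose i : ℝ) * (-(2 * Real.pi)) ^ i) • (i.descFactorial m : ℝ) •
        (star (slicePt I p) ^ (i - m) * restr (sderiv^[j - i] H) I p) := by
  have e : restr (sliceTruePoly j H) I = fun p => ∑ i ∈ range (j + 1),
      ((j.choose i : ℝ) * (-(2 * Real.pi)) ^ i) •
        (star (slicePt I p) ^ i * restr (sderiv^[j - i] H) I p) := rfl
  have hs : ∀ i, ContDiff ℝ ∞ (restr (sderiv^[j - i] H) I) := fun i =>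
    (hH.sderiv_iterate _).contDiff_restr hI
  have hs' : ∀ i, ContDiff ℝ m
      (fun p => star (slicePt I p) ^ i * restr (sderiv^[j - i] H) I p) := fun i =>
    (contDiff_star_slicePt_pow_mul hI i (hs i)).of_le (by exact_mod_cast le_top)
  rw [e, dbar_iterate_sum m _ fun i _ => (hs' i).const_smul _]
  funext p
  refine sum_congr rfl fun i _ => ?_
  rw [dbar_iterate_smul m _ (hs' i), dbar_iterate_star_pow_mul hI (hs i)
    ((isSliceRegular_iff.1 (hH.sderiv_iterate _)).2 I hI)]

lemma IsSliceRegular.isSlicePolyanalytic_sliceTruePoly {H : ℍ → ℍ} (hH : IsSliceRegular H)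
    {j m : ℕ} (h : j < m) : IsSlicePolyanalytic m (sliceTruePoly j H) := by
  refine isSlicePolyanalytic_iff.2
    ⟨(hH.isSlice_sliceTruePoly j).of_le (by exact_mod_cast le_top), fun I hI p => ?_⟩
  rw [dbar_iterate_restr_sliceTruePoly hH j m hI]
  refine sum_eq_zero fun i hi => ?_
  rw [Nat.descFactorial_eq_zero_iff_lt.2 (by have := mem_range.1 hi; lia)]
  simp

/-- Only the top power `q̄^n`, whose coefficient is `(-2π)^n H`, survives `n` applications of `∂̄`.
-/
lemma dbar_iterate_self_restr_sliceTruePoly {H : ℍ → ℍ} (hH : IsSliceRegular H) (n : ℕ) {I : ℍ}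
    (hI : I ∈ imagUnits) (p : ℝ × ℝ) :
    (dbar I)^[n] (restr (sliceTruePoly n H) I) p =
      ((-(2 * Real.pi)) ^ n * n.factorial) • restr H I p := by
  rw [dbar_iterate_restr_sliceTruePoly hH n n hI]
  dsimp only
  rw [sum_range_succ, sum_eq_zero]
  · simp [Nat.descFactorial_self, smul_smul]
  · intro i hi
    rw [Nat.descFactorial_eq_zero_iff_lt.2 (mem_range.1 hi)]
    simp

lemma sliceTruePoly_smul (H : ℍ → ℍ) (c : ℝ) (j : ℕ) :
    sliceTruePoly j (fun q => c • H q) = fun q => c • sliceTruePoly j H q := by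
  have h : ∀ k, sderiv^[k] (fun q => c • H q) = fun q => c • sderiv^[k] H q := by
    intro k
    induction k with
    | zero => rfl
    | succ k ih =>
      rw [Function.iterate_succ_apply', ih, Function.iterate_succ_apply']
      funext q
      exact deriv_const_smul_field c _
  funext q
  simp only [sliceTruePoly, h, smul_sum]
  refine sum_congr rfl fun i _ => ?_
  rw [mul_smul_comm, smul_comm]

lemma IsSliceRegular.smul {H : ℍ → ℍ} (hH : IsSliceRegular H) (c : ℝ) :
    IsSliceRegular (fun q => c • H q) := by
  have h := IsSlicePolyanalytic.mul_right hH (c : ℍ)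
  simp only [Quaternion.mul_coe_eq_smul] at h
  exact h

/-- The leading term of a slice polyanalytic function. -/
lemma IsSlicePolyanalytic.exists_sub_sliceTruePoly {n : ℕ} {f : ℍ → ℍ}
    (hf : IsSlicePolyanalytic (n + 1) f) :
    ∃ H, IsSliceRegular H ∧ IsSlicePolyanalytic n (fun q => f q - sliceTruePoly n H q) := by
  obtain ⟨h1, h2⟩ := isSlicePolyanalytic_iff.1 hf
  obtain ⟨g, hg, hgr⟩ := IsSlice.exists_dbar_iterate (m := 1) n
    (h1.of_le (by norm_cast; rw [add_comm]))
  -- `g = ∂̄^n f` is annihilated by one more `∂̄`; divided by the constant `c` below it is the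
  -- required `H`.
  have hgreg : IsSliceRegular g := by
    refine isSlicePolyanalytic_iff.2 ⟨hg, fun I hI p => ?_⟩
    rw [hgr I hI, ← Function.iterate_add_apply, add_comm]
    exact h2 I hI p
  set c : ℝ := (-(2 * Real.pi)) ^ n * n.factorial with hc
  have hc0 : c ≠ 0 := mul_ne_zero (pow_ne_zero _ (by simp [Real.pi_ne_zero]))
    (by exact_mod_cast n.factorial_ne_zero)
  let H : ℍ → ℍ := fun q => c⁻¹ • g q
  have hH : IsSliceRegular H := hgreg.smul c⁻¹
  have hT := (hH.isSlice_sliceTruePoly n).of_le (k := n) (by exact_mod_cast le_top)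
  have hf' : IsSlice n f := h1.of_le (by norm_cast; lia)
  have hsub : (fun q => f q - sliceTruePoly n H q) =
      fun q => f q + (-1 : ℝ) • sliceTruePoly n H q := by
    funext q; module
  refine ⟨H, hH, ?_⟩
  rw [hsub]
  refine isSlicePolyanalytic_iff.2 ⟨hf'.add (hT.smul _), fun I hI p => ?_⟩
  have e : restr (fun q => f q + (-1 : ℝ) • sliceTruePoly n H q) I =
      fun p => restr f I p + (-1 : ℝ) • restr (sliceTruePoly n H) I p := rfl
  rw [e, dbar_iterate_add n (hf'.contDiff_restr hI) ((hT.contDiff_restr hI).const_smul _),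
    dbar_iterate_smul n _ (hT.contDiff_restr hI)]
  simp only [dbar_iterate_self_restr_sliceTruePoly hH n hI, ← hgr I hI, ← hc]
  rw [show restr H I p = c⁻¹ • restr g I p from rfl, smul_smul c, mul_inv_cancel₀ hc0]
  module

lemma IsSlicePolyanalytic.exists_eq_sum {n : ℕ} {f : ℍ → ℍ} (hf : IsSlicePolyanalytic n f) :
    ∃ H : ℕ → ℍ → ℍ, (∀ j, IsSliceRegular (H j)) ∧
      f = fun q => ∑ j ∈ range n, sliceTruePoly j (H j) q := by
  induction n generalizing f with
  | zero =>
    -- At order `0` the equation with no derivatives says `f = 0`, matching the empty sum.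
    refine ⟨fun _ => 0, fun _ => IsSlicePolyanalytic.zero 1, IsSlice.ext_restr fun I hI p => ?_⟩
    exact (isSlicePolyanalytic_iff.1 hf).2 I hI p
  | succ n ih =>
    obtain ⟨H, hH, hg⟩ := hf.exists_sub_sliceTruePoly
    obtain ⟨K, hK, e⟩ := ih hg
    refine ⟨fun j => if j = n then H else K j, fun j => by
      dsimp only; split_ifs; exacts [hH, hK j], ?_⟩
    funext q
    have := congrFun e q
    rw [sub_eq_iff_eq_add] at this
    simp only [this, sum_range_succ, if_pos]
    congr 1
    refine sum_congr rfl fun j hj => ?_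
    rw [if_neg (mem_range.1 hj).ne]

/-- Pascal's rule: one more factor `∂_s - 2π q̄`, with `∂_s` moved past the powers of `q̄` onto `H`.
-/
lemma sliceTruePoly_succ (j : ℕ) (H : ℍ → ℍ) (q : ℍ) :
    sliceTruePoly (j + 1) H q =
      sliceTruePoly j (sderiv H) q + (-(2 * Real.pi)) • (star q * sliceTruePoly j H q) := by
  let t : ℕ → ℕ → ℍ := fun i k => (-(2 * Real.pi)) ^ i • (star q ^ i * sderiv^[k] H q)
  have e : ∀ j, sliceTruePoly j H q = ∑ ij ∈ antidiagonal j, j.choose ij.1 • t ij.1 ij.2 := by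
    intro j
    rw [Nat.sum_antidiagonal_eq_sum_range_succ (fun i k => j.choose i • t i k), sliceTruePoly]
    refine sum_congr rfl fun i _ => ?_
    rw [← Nat.cast_smul_eq_nsmul ℝ, smul_smul]
  have e' : sliceTruePoly j (sderiv H) q =
      ∑ ij ∈ antidiagonal j, j.choose ij.1 • t ij.1 (ij.2 + 1) := by
    rw [Nat.sum_antidiagonal_eq_sum_range_succ (fun i k => j.choose i • t i (k + 1)),
      sliceTruePoly]
    refine sum_congr rfl fun i _ => ?_
    rw [← Nat.cast_smul_eq_nsmul ℝ, smul_smul, Function.iterate_succ_apply]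
  rw [e, sum_antidiagonal_choose_succ_nsmul, e', e, mul_sum, smul_sum]
  congr 1
  refine sum_congr rfl fun ij hij => ?_
  rw [Nat.choose_symm_of_eq_add (mem_antidiagonal.1 hij).symm]
  simp only [t, pow_succ', mul_smul_comm, mul_assoc, smul_smul,
    ← Nat.cast_smul_eq_nsmul ℝ]
  congr 1
  ring

lemma dslice_smul {I : ℍ} (c : ℝ) {g : ℝ × ℝ → ℍ} (hg : Differentiable ℝ g) :
    dslice I (fun p => c • g p) = fun p => c • dslice I g p := by
  have h := dslice_mul_right (I := I) hg (c : ℍ)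
  simpa only [Quaternion.mul_coe_eq_smul] using h

lemma dslice_zero (I : ℍ) : dslice I (fun _ => 0) = fun _ => 0 := by
  simpa using dslice_smul (I := I) 0 (g := fun _ => 0) (differentiable_const _)

lemma dslice_sum {I : ℍ} {ι : Type*} (s : Finset ι) {g : ι → ℝ × ℝ → ℍ}
    (hg : ∀ i ∈ s, Differentiable ℝ (g i)) :
    dslice I (fun p => ∑ i ∈ s, g i p) = fun p => ∑ i ∈ s, dslice I (g i) p := by
  classical
  induction s using Finset.induction_on with
  | empty => simpa using dslice_zero I
  | insert i s hi ih =>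
    simp only [Finset.sum_insert hi]
    rw [dslice_add (hg i (by simp)) (Differentiable.fun_sum fun j hj => hg j (by simp [hj])),
      ih fun j hj => hg j (by simp [hj])]

lemma dslice_star_pow_mul {I : ℍ} (hI : I ∈ imagUnits) {h : ℝ × ℝ → ℍ} (hh : ContDiff ℝ ∞ h)
    (i : ℕ) :
    dslice I (fun p => star (slicePt I p) ^ i * h p) =
      fun p => star (slicePt I p) ^ i * dslice I h p := by
  induction i with
  | zero => simp
  | succ i ih =>
    simp only [pow_succ', mul_assoc]
    rw [dslice_star_mul hI
      ((contDiff_star_slicePt_pow_mul hI i hh).differentiable (by simp)), ih]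

/-- Since `∂_I q̄ = 0`, the slice derivative passes through the powers of `q̄`. -/
lemma IsSliceRegular.dslice_restr_sliceTruePoly {H : ℍ → ℍ} (hH : IsSliceRegular H) (j : ℕ)
    {I : ℍ} (hI : I ∈ imagUnits) :
    dslice I (restr (sliceTruePoly j H) I) = restr (sliceTruePoly j (SliceFock.sderiv H)) I := by
  have e : restr (sliceTruePoly j H) I = fun p => ∑ i ∈ range (j + 1),
      ((j.choose i : ℝ) * (-(2 * Real.pi)) ^ i) •
        (star (slicePt I p) ^ i * restr (SliceFock.sderiv^[j - i] H) I p) := rfl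
  have hs : ∀ i, ContDiff ℝ ∞ (restr (SliceFock.sderiv^[j - i] H) I) := fun i =>
    (hH.sderiv_iterate _).contDiff_restr hI
  have hd : ∀ i, Differentiable ℝ
      (fun p => star (slicePt I p) ^ i * restr (SliceFock.sderiv^[j - i] H) I p) := fun i =>
    (contDiff_star_slicePt_pow_mul hI i (hs i)).differentiable (by simp)
  rw [e, dslice_sum _ fun i _ => (hd i).fun_const_smul _]
  funext p
  refine sum_congr rfl fun i _ => ?_
  rw [dslice_smul _ (hd i), dslice_star_pow_mul hI (hs i), (hH.sderiv_iterate _).dslice_restr hI]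
  simp only [restr, ← Function.iterate_succ_apply' SliceFock.sderiv,
    ← Function.iterate_succ_apply SliceFock.sderiv]

lemma dslice_gaussian_smul {I : ℍ} (hI : I ∈ imagUnits) {g : ℝ × ℝ → ℍ}
    (hg : Differentiable ℝ g) :
    dslice I (fun p => Real.exp (-(2 * Real.pi * (p.1 ^ 2 + p.2 ^ 2))) • g p) = fun p =>
      Real.exp (-(2 * Real.pi * (p.1 ^ 2 + p.2 ^ 2))) •
        (dslice I g p + (-(2 * Real.pi)) • (star (slicePt I p) * g p)) := by
  funext p
  have hw : HasFDerivAt (fun p : ℝ × ℝ => Real.exp (-(2 * Real.pi * (p.1 ^ 2 + p.2 ^ 2))))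
      (Real.exp (-(2 * Real.pi * (p.1 ^ 2 + p.2 ^ 2))) • -((2 * Real.pi) •
        ((2 * p.1) • ContinuousLinearMap.fst ℝ ℝ ℝ + (2 * p.2) • ContinuousLinearMap.snd ℝ ℝ ℝ)))
      p := by
    refine HasFDerivAt.exp (HasFDerivAt.neg (HasFDerivAt.const_mul (HasFDerivAt.add ?_ ?_) _))
    · simpa using (hasFDerivAt_fst (𝕜 := ℝ) (p := p)).pow 2
    · simpa using (hasFDerivAt_snd (𝕜 := ℝ) (p := p)).pow 2
  have h := (hw.smul (hg p).hasFDerivAt).fderiv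
  have hv : ∀ v, fderiv ℝ (fun p => Real.exp (-(2 * Real.pi * (p.1 ^ 2 + p.2 ^ 2))) • g p) p v =
      Real.exp (-(2 * Real.pi * (p.1 ^ 2 + p.2 ^ 2))) • fderiv ℝ g p v +
      (Real.exp (-(2 * Real.pi * (p.1 ^ 2 + p.2 ^ 2))) *
        -(2 * Real.pi * (2 * p.1 * v.1 + 2 * p.2 * v.2))) • g p := fun v => by
    refine (DFunLike.congr_fun h v).trans ?_
    simp
    rw [← neg_smul]
    congr 1
    ring
  rw [dslice, hv, hv, dslice, star_slicePt hI]
  simp only [mul_add, mul_smul_comm, sub_mul, smul_mul_assoc, one_mul]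
  module

/-- Because `∂_I e^{-2π|q|²} = -2π q̄ e^{-2π|q|²}`, each derivative of the weighted function
contributes one factor `∂_s - 2π q̄`. -/
lemma dslice_iterate_gaussian {H : ℍ → ℍ} (hH : IsSliceRegular H) (j : ℕ) {I : ℍ}
    (hI : I ∈ imagUnits) :
    (dslice I)^[j] (restr (fun q => Real.exp (-(2 * Real.pi * ‖q‖ ^ 2)) • H q) I) = fun p =>
      Real.exp (-(2 * Real.pi * (p.1 ^ 2 + p.2 ^ 2))) • restr (sliceTruePoly j H) I p := by
  induction j with
  | zero =>
    funext p
    simp [restr, norm_slicePt_sq hI, sliceTruePoly]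
  | succ j ih =>
    rw [Function.iterate_succ_apply', ih, dslice_gaussian_smul hI
      (((hH.isSlice_sliceTruePoly j).contDiff_restr hI).differentiable (by simp)),
      hH.dslice_restr_sliceTruePoly j hI]
    funext p
    simp only [restr, sliceTruePoly_succ]

/-- The normalising constant of the true polyanalytic Fock space. -/
def truePolyConst (j : ℕ) : ℝ :=
  (-1) ^ j * Real.sqrt (1 / ((2 * Real.pi) ^ j * (j.factorial : ℝ)))

lemma truePolyConst_ne_zero (j : ℕ) : truePolyConst j ≠ 0 := by
  have := Real.pi_pos
  exact mul_ne_zero (pow_ne_zero _ (by norm_num)) (Real.sqrt_pos.2 (by positivity)).ne'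

lemma isTruePolyOf_iff {H : ℍ → ℍ} (hH : IsSliceRegular H) {j : ℕ} {f : ℍ → ℍ} :
    IsTruePolyOf j f H ↔ f = fun q => truePolyConst j • sliceTruePoly j H q := by
  have key : ∀ J ∈ imagUnits, ∀ p : ℝ × ℝ,
      ((-1) ^ j * Real.sqrt (1 / ((2 * Real.pi) ^ j * (j.factorial : ℝ))) *
          Real.exp (2 * Real.pi * ‖slicePt J p‖ ^ 2)) •
        (dslice J)^[j]
          (restr (fun q => Real.exp (-(2 * Real.pi * ‖q‖ ^ 2)) • H q) J) p =
      truePolyConst j • restr (sliceTruePoly j H) J p := by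
    intro J hJ p
    rw [dslice_iterate_gaussian hH j hJ, norm_slicePt_sq hJ, smul_smul, mul_assoc, ← Real.exp_add,
      add_neg_cancel, Real.exp_zero, mul_one, truePolyConst]
  constructor
  · intro h
    refine IsSlice.ext_restr fun J hJ p => ?_
    rw [h J hJ p, key J hJ p]
    rfl
  · rintro rfl J hJ p
    rw [key J hJ p]
    rfl

/-- The nonzero normalising constant is absorbed into `H`. -/
lemma mem_truePolyFock {I : imagUnits} {j : ℕ} {f : ℍ → ℍ} :
    f ∈ truePolyFock I j ↔
      FockIntegrable I f ∧ ∃ H, IsSliceRegular H ∧ f = sliceTruePoly j H := by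
  refine and_congr_right fun _ => ⟨?_, ?_⟩
  · rintro ⟨H, hH, h⟩
    refine ⟨_, hH.smul (truePolyConst j), ?_⟩
    rw [sliceTruePoly_smul, (isTruePolyOf_iff hH).1 h]
  · rintro ⟨H, hH, rfl⟩
    refine ⟨_, hH.smul (truePolyConst j)⁻¹, (isTruePolyOf_iff (hH.smul _)).2 ?_⟩
    rw [sliceTruePoly_smul]
    funext q
    rw [smul_inv_smul₀ (truePolyConst_ne_zero j)]

/-! ### Restriction to a slice as a holomorphic function -/

lemma isScalarTower_complexModule {I : ℍ} (hI : I ∈ imagUnits) :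
    letI := complexNormedSpace hI
    IsScalarTower ℝ ℂ ℍ := by
  let _ := complexNormedSpace hI
  refine IsScalarTower.of_algebraMap_smul fun r q => ?_
  refine (complexModule_smul hI _ q).trans ?_
  rw [← Quaternion.coe_mul_eq_smul]
  simp [slicePt]

lemma IsSliceRegular.hasDerivAt {H : ℍ → ℍ} (hH : IsSliceRegular H) {I : ℍ}
    (hI : I ∈ imagUnits) (z : ℂ) :
    letI := complexNormedSpace hI
    HasDerivAt (fun z : ℂ => restr H I (z.re, z.im))
      (restr (SliceFock.sderiv H) I (z.re, z.im)) z := by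
  let _ := complexNormedSpace hI
  have _ : IsScalarTower ℝ ℂ ℍ := isScalarTower_complexModule hI
  have hsm : ∀ (z : ℂ) (q : ℍ), z • q = slicePt I (z.re, z.im) * q := complexModule_smul hI
  have hd := hH.differentiable_restr hI
  have hcr := fun p => (dbar_eq_zero_iff hI).1 ((isSliceRegular_iff.1 hH).2 I hI p)
  have hz : HasFDerivAt (fun z : ℂ => restr H I (z.re, z.im))
      ((fderiv ℝ (restr H I) (Complex.equivRealProdCLM z)).comp
        (Complex.equivRealProdCLM : ℂ →L[ℝ] ℝ × ℝ)) z :=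
    (hd _).hasFDerivAt.comp z Complex.equivRealProdCLM.hasFDerivAt
  have hL : ((ContinuousLinearMap.toSpanSingleton ℂ
        (restr (SliceFock.sderiv H) I (z.re, z.im))).restrictScalars ℝ) =
      (fderiv ℝ (restr H I) (Complex.equivRealProdCLM z)).comp
        (Complex.equivRealProdCLM : ℂ →L[ℝ] ℝ × ℝ) := by
    ext1 w
    have hw : Complex.equivRealProdCLM w = w.re • ((1, 0) : ℝ × ℝ) + w.im • ((0, 1) : ℝ × ℝ) := by
      simp [Complex.equivRealProdCLM_apply]
    simp only [ContinuousLinearMap.coe_restrictScalars', ContinuousLinearMap.comp_apply,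
      ContinuousLinearEquiv.coe_coe, ContinuousLinearMap.toSpanSingleton_apply]
    rw [hw, map_add, map_smul, map_smul, hcr, hsm, slicePt, add_mul, Quaternion.coe_mul_eq_smul,
      mul_assoc, Quaternion.coe_mul_eq_smul, mul_smul_comm, restr_sderiv hd]
    rfl
  exact hasDerivAt_iff_hasFDerivAt.2 (hasFDerivAt_of_restrictScalars ℝ hz hL)

lemma IsSliceRegular.iteratedDeriv_restr {H : ℍ → ℍ} (hH : IsSliceRegular H) {I : ℍ}
    (hI : I ∈ imagUnits) (k : ℕ) :
    letI := complexNormedSpace hI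
    iteratedDeriv k (fun z : ℂ => restr H I (z.re, z.im)) =
      fun z => restr (SliceFock.sderiv^[k] H) I (z.re, z.im) := by
  let _ := complexNormedSpace hI
  induction k with
  | zero => simp
  | succ k ih =>
    rw [iteratedDeriv_succ, ih]
    funext z
    rw [Function.iterate_succ_apply']
    exact ((hH.sderiv_iterate k).hasDerivAt hI z).deriv

/-- The bridge to the complex estimates: `w ↦ w.re + I w.im` is an algebra map `ℂ → ℍ` respecting
conjugation, and iterated complex derivatives are iterated slice derivatives. -/
lemma IsSliceRegular.truePoly_restr {H : ℍ → ℍ} (hH : IsSliceRegular H) {I : ℍ}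
    (hI : I ∈ imagUnits) (j : ℕ) (z : ℂ) :
    letI := complexNormedSpace hI
    truePoly j (fun z : ℂ => restr H I (z.re, z.im)) z =
      restr (sliceTruePoly j H) I (z.re, z.im) := by
  let _ := complexNormedSpace hI
  let φ : ℂ →ₐ[ℝ] ℍ := Complex.lift ⟨I, mul_self_imagUnit hI⟩
  have hφ : ∀ w : ℂ, φ w = slicePt I (w.re, w.im) := fun w => by
    have := complexModule_smul hI w 1
    rw [mul_one] at this
    rw [← this]
    exact (mul_one _).symm
  have hstar : φ (star z) = star (slicePt I (z.re, z.im)) := by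
    rw [hφ, star_slicePt hI, slicePt, ← Quaternion.coe_commutes, Quaternion.coe_mul_eq_smul,
      ← mul_one (((star z).re : ℝ) : ℍ), Quaternion.coe_mul_eq_smul]
    simp [sub_eq_add_neg]
  simp only [truePoly, restr, sliceTruePoly]
  refine sum_congr rfl fun i _ => ?_
  have e := congrFun (hH.iteratedDeriv_restr hI (j - i)) z
  refine (congrArg _ e).trans ?_
  change φ _ * _ = _
  have e2 : ((j.choose i : ℂ) * (-(2 * Real.pi) * star z) ^ i) =
      (((j.choose i : ℝ) * (-(2 * Real.pi)) ^ i : ℝ) : ℂ) * star z ^ i := by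
    push_cast; ring
  rw [e2, map_mul, map_pow, hstar, mul_assoc]
  have e3 : ∀ r : ℝ, φ (r : ℂ) = (r : ℍ) := fun r => φ.commutes r
  rw [e3, Quaternion.coe_mul_eq_smul]
  rfl

/-! ### Integrability -/

lemma fockIntegrable_iff_lintegral {f : ℍ → ℍ} {I : ℍ} (hI : I ∈ imagUnits)
    (hf : Continuous (restr f I)) :
    FockIntegrable I f ↔
      ∫⁻ z : ℂ, fockDensity (fun z : ℂ => restr f I (z.re, z.im)) z < ⊤ := by
  have hc : Continuous fun p : ℝ × ℝ =>
      ‖restr f I p‖ ^ 2 * Real.exp (-(2 * Real.pi * ‖slicePt I p‖ ^ 2)) := by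
    simp only [norm_slicePt_sq hI]
    fun_prop
  rw [FockIntegrable, Integrable, and_iff_right hc.aestronglyMeasurable, HasFiniteIntegral,
    ← Complex.volume_preserving_equiv_real_prod.lintegral_comp hc.enorm.measurable]
  refine iff_of_eq (congrArg (· < _) (lintegral_congr fun z => ?_))
  rw [Real.enorm_of_nonneg (by positivity), ENNReal.ofReal_mul (by positivity), fockDensity,
    ENNReal.ofReal_pow (norm_nonneg _), ofReal_norm, norm_slicePt_sq hI, Complex.sq_norm,
    Complex.normSq_apply]
  simp only [Complex.measurableEquivRealProd_apply, sq]

/-- The representation formula dominates the slice `ℂ_J` by `ℂ_I` and its reflection `y ↦ -y`, which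
preserves both the measure and the weight. -/
lemma IsSlice.fockIntegrable {f : ℍ → ℍ} (hf : IsSlice 0 f) {I J : ℍ} (hI : I ∈ imagUnits)
    (hJ : J ∈ imagUnits) (h : FockIntegrable I f) : FockIntegrable J f := by
  have hconj : MeasurePreserving (fun p : ℝ × ℝ => (p.1, -p.2)) volume volume :=
    (MeasurePreserving.id (volume : Measure ℝ)).prod (Measure.measurePreserving_neg volume)
  have h' := hconj.integrable_comp_of_integrable h
  have hcJ := (hf.contDiff_restr hJ).continuous
  refine ((h.const_mul 2).add (h'.const_mul 2)).mono' ?_ (Filter.Eventually.of_forall fun p => ?_)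
  · refine Continuous.aestronglyMeasurable ?_
    simp only [norm_slicePt_sq hJ]
    fun_prop
  · have hE := (Real.exp_pos (-(2 * Real.pi * (p.1 ^ 2 + p.2 ^ 2)))).le
    rw [Real.norm_of_nonneg (by positivity)]
    simp only [Pi.add_apply, Function.comp, norm_slicePt_sq hI, norm_slicePt_sq hJ, neg_sq]
    have h1 := hf.norm_restr_le hI hJ p
    have h2 : ‖restr f J p‖ ^ 2 ≤
        2 * ‖restr f I p‖ ^ 2 + 2 * ‖restr f I (p.1, -p.2)‖ ^ 2 := by
      nlinarith [sq_nonneg (‖restr f I p‖ - ‖restr f I (p.1, -p.2)‖), norm_nonneg (restr f J p)]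
    have h3 := mul_le_mul_of_nonneg_right h2 hE
    linarith

lemma sliceTruePoly_eq_zero_of_sum_eq_zero (n : ℕ) {H : ℕ → ℍ → ℍ}
    (hH : ∀ j, IsSliceRegular (H j))
    (h0 : ∀ q, ∑ j ∈ range (n + 1), sliceTruePoly j (H j) q = 0) :
    sliceTruePoly n (H n) = fun _ => 0 := by
  refine IsSlice.ext_restr fun I hI p => ?_
  let _ := complexNormedSpace hI
  have h := truePoly_eq_zero_of_sum_eq_zero n
    (H := fun j (z : ℂ) => restr (H j) I (z.re, z.im))
    (fun j z => ((hH j).hasDerivAt hI z).differentiableAt)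
    (fun z => by
      refine (sum_congr rfl fun j _ => (hH j).truePoly_restr hI j z).trans ?_
      exact h0 _) ⟨p.1, p.2⟩
  exact ((hH n).truePoly_restr hI n ⟨p.1, p.2⟩).symm.trans h

lemma fockIntegrable_sliceTruePoly (n : ℕ) {H : ℕ → ℍ → ℍ} (hH : ∀ j, IsSliceRegular (H j))
    {I : ℍ} (hI : I ∈ imagUnits)
    (h : FockIntegrable I (fun q => ∑ j ∈ range (n + 1), sliceTruePoly j (H j) q)) :
    FockIntegrable I (sliceTruePoly n (H n)) := by
  have hs : ∀ j, IsSlice ∞ (sliceTruePoly j (H j)) := fun j => (hH j).isSlice_sliceTruePoly j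
  have hsum : IsSlice ∞ (fun q => ∑ j ∈ range (n + 1), sliceTruePoly j (H j) q) :=
    IsSlice.sum _ fun j _ => hs j
  rw [fockIntegrable_iff_lintegral hI (hsum.contDiff_restr hI).continuous] at h
  rw [fockIntegrable_iff_lintegral hI ((hs n).contDiff_restr hI).continuous]
  let _ := complexNormedSpace hI
  have e : ∀ j, (fun z : ℂ => restr (sliceTruePoly j (H j)) I (z.re, z.im)) =
      truePoly j (fun z : ℂ => restr (H j) I (z.re, z.im)) := fun j =>
    funext fun z => ((hH j).truePoly_restr hI j z).symm
  rw [e]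
  refine lintegral_fockDensity_truePoly_lt_top n
    (H := fun j (z : ℂ) => restr (H j) I (z.re, z.im))
    (fun j z => ((hH j).hasDerivAt hI z).differentiableAt) ?_
  refine lt_of_eq_of_lt ?_ h
  refine lintegral_congr fun z => congrArg (fun g => fockDensity g z) (funext fun z => ?_)
  exact sum_congr rfl fun j _ => (hH j).truePoly_restr hI j z

/-! ### The decomposition -/

lemma polyFock_eq (I J : imagUnits) (m : ℕ) : polyFock I m = polyFock J m := by
  have key : ∀ I J : imagUnits, polyFock I m ≤ polyFock J m := fun I J f hf =>
    ⟨hf.1, ((isSlicePolyanalytic_iff.1 hf.1).1.of_le zero_le).fockIntegrable I.2 J.2 hf.2⟩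
  exact le_antisymm (key I J) (key J I)

lemma truePolyFock_eq (I J : imagUnits) (j : ℕ) : truePolyFock I j = truePolyFock J j := by
  have key : ∀ I J : imagUnits, truePolyFock I j ≤ truePolyFock J j := by
    intro I J f hf
    obtain ⟨h1, H, hH, rfl⟩ := mem_truePolyFock.1 hf
    exact mem_truePolyFock.2
      ⟨((hH.isSlice_sliceTruePoly j).of_le zero_le).fockIntegrable I.2 J.2 h1, H, hH, rfl⟩
  exact le_antisymm (key I J) (key J I)

lemma truePolyFock_le_polyFock (I : imagUnits) {j m : ℕ} (h : j < m) :
    truePolyFock I j ≤ polyFock I m := by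
  intro f hf
  obtain ⟨h1, H, hH, rfl⟩ := mem_truePolyFock.1 hf
  exact ⟨hH.isSlicePolyanalytic_sliceTruePoly h, h1⟩

/-- The top component is integrable, hence so is the rest of the sum, and induction applies. The
target `S` is kept abstract so that it stays fixed while the sum shortens. -/
lemma sum_sliceTruePoly_mem (I : imagUnits) {H : ℕ → ℍ → ℍ} (hH : ∀ j, IsSliceRegular (H j))
    (S : Submodule ℍᵐᵒᵖ (ℍ → ℍ)) (n : ℕ) (hS : ∀ j < n, truePolyFock I j ≤ S)
    (h : FockIntegrable I (fun q => ∑ j ∈ range n, sliceTruePoly j (H j) q)) :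
    (fun q => ∑ j ∈ range n, sliceTruePoly j (H j) q) ∈ S := by
  induction n with
  | zero => simp only [range_zero, sum_empty]; exact S.zero_mem
  | succ n ih =>
    have hn : sliceTruePoly n (H n) ∈ truePolyFock I n :=
      mem_truePolyFock.2 ⟨fockIntegrable_sliceTruePoly n hH I.2 h, H n, hH n, rfl⟩
    have hs : ∀ j, IsSlice ∞ (sliceTruePoly j (H j)) := fun j => (hH j).isSlice_sliceTruePoly j
    have hsub := h.add (hn.1.mul_right (-1))
      ((IsSlice.sum _ fun j _ => hs j).contDiff_restr I.2).continuous
      (((hs n).contDiff_restr I.2).continuous.mul continuous_const)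
    have e : (fun q => ∑ j ∈ range (n + 1), sliceTruePoly j (H j) q) +
        (fun q => sliceTruePoly n (H n) q * (-1)) =
        fun q => ∑ j ∈ range n, sliceTruePoly j (H j) q := by
      funext q
      simp [sum_range_succ]
    rw [e] at hsub
    have := S.add_mem (ih (fun j hj => hS j (hj.trans n.lt_succ_self)) hsub)
      (hS n n.lt_succ_self hn)
    refine (congrArg (· ∈ S) ?_).mp this
    funext q
    simp [sum_range_succ]

lemma iSup_truePolyFock (I : imagUnits) (n : ℕ) :
    ⨆ j : Fin (n + 1), truePolyFock I j = polyFock I (n + 1) := by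
  refine le_antisymm (iSup_le fun j => truePolyFock_le_polyFock I j.2) fun f hf => ?_
  obtain ⟨H, hH, rfl⟩ := hf.1.exists_eq_sum
  exact sum_sliceTruePoly_mem I hH _ _
    (fun j hj => le_iSup (fun j : Fin (n + 1) => truePolyFock I j) ⟨j, hj⟩) hf.2

lemma sliceTruePoly_eq_zero_of_sum_range_eq_zero (n : ℕ) {H : ℕ → ℍ → ℍ}
    (hH : ∀ j, IsSliceRegular (H j))
    (h0 : ∀ q, ∑ j ∈ range n, sliceTruePoly j (H j) q = 0) :
    ∀ j < n, sliceTruePoly j (H j) = fun _ => 0 := by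
  induction n with
  | zero => simp
  | succ n ih =>
    have hn := sliceTruePoly_eq_zero_of_sum_eq_zero n hH h0
    intro j hj
    rcases Nat.lt_succ_iff_lt_or_eq.1 hj with h | rfl
    · refine ih (fun q => ?_) j h
      simpa [sum_range_succ, hn] using h0 q
    · exact hn

lemma iSupIndep_truePolyFock (I : imagUnits) (n : ℕ) :
    iSupIndep (fun j : Fin n => truePolyFock I j) := by
  classical
  rw [iSupIndep_iff_finsetSum_eq_zero_imp_eq_zero]
  intro s v hv hsum
  have hv' : ∀ j : Fin n, ∃ H, IsSliceRegular H ∧ (if j ∈ s then v j else 0) =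
      sliceTruePoly j H := by
    intro j
    have : (if j ∈ s then v j else 0) ∈ truePolyFock I j := by
      split_ifs with h
      exacts [hv j h, zero_mem _]
    exact (mem_truePolyFock.1 this).2
  choose H hH hvH using hv'
  -- Extension by zero to a family indexed by `ℕ`, the form in which the top component can be peeled
  -- off by induction.
  let K : ℕ → ℍ → ℍ := fun j => if h : j < n then H ⟨j, h⟩ else fun _ => 0
  have hK : ∀ j, IsSliceRegular (K j) := fun j => by
    simp only [K]
    split_ifs
    exacts [hH _, IsSlicePolyanalytic.zero 1]
  have hKv : ∀ j : Fin n, sliceTruePoly j (K j) = if j ∈ s then v j else 0 := fun j => by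
    simp only [K, j.2, dif_pos, hvH]
  have h0 : ∀ q, ∑ j ∈ range n, sliceTruePoly j (K j) q = 0 := by
    intro q
    rw [← Fin.sum_univ_eq_sum_range (fun j => sliceTruePoly j (K j) q)]
    simp only [hKv]
    have := congrFun hsum q
    rw [← sum_ite_mem_eq s v] at this
    rw [← Finset.sum_apply]
    exact this
  intro j hj
  have := sliceTruePoly_eq_zero_of_sum_range_eq_zero n hK h0 j j.2
  rw [hKv, if_pos hj] at this
  exact this

end SliceFock

end

theorem mainTheorem1 (n : ℕ) :
    -- the spaces do not depend on the slice on which the integral is taken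
    (∀ I J : SliceFock.imagUnits,
      SliceFock.polyFock I (n + 1) = SliceFock.polyFock J (n + 1)) ∧
    (∀ (I J : SliceFock.imagUnits) (j : Fin (n + 1)),
      SliceFock.truePolyFock I j = SliceFock.truePolyFock J j) ∧
    -- the direct sum decomposition
    (∀ I : SliceFock.imagUnits,
      iSupIndep (fun j : Fin (n + 1) => SliceFock.truePolyFock I j) ∧
      ⨆ j : Fin (n + 1), SliceFock.truePolyFock I j = SliceFock.polyFock I (n + 1)) :=
  ⟨fun I J => SliceFock.polyFock_eq I J _, fun I J j => SliceFock.truePolyFock_eq I J j,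
    fun I => ⟨SliceFock.iSupIndep_truePolyFock I _, SliceFock.iSup_truePolyFock I n⟩⟩
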